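/- \textbf{Model.} The two-way heterogeneity model (TWHM) on $p$ nodes with parameter $\theta=(\beta_{i,r})_{1\le i\le p,\ r\in\{0,1\}}$ is the process of undirected networks without self-loops $X^t=(X^t_{i,j})$, $t\ge 0$, with $X^t_{i,j}=I(\varepsilon^t_{i,j}=0)+X^{t-1}_{i,j}I(\varepsilon^t_{i,j}=1)$ for $i<j$, $t\ge1$, where, writing $\alpha_{r,i,j}=e^{\beta_{i,r}+\beta_{j,r}}$, $P(\varepsilon^t_{i,j}=r)=\alpha_{r,i,j}/(1+\alpha_{0,i,j}+\alpha_{1,i,j})$ for $r=0,1$, $P(\varepsilon^t_{i,j}=-1)=1/(1+\alpha_{0,i,j}+\alpha_{1,i,j})$, the initial edges are Bernoulli with $P(X^0_{i,j}=1)=\alpha_{0,i,j}/(1+\alpha_{0,i,j})$ (so that the process is stationary), and all $X^0_{i,j}$ and $\varepsilon^t_{i,j}$ ($i<j$, $t\ge 1$) are independent. Denote this law by $P_\theta$. \textbf{Estimator.} Given $X^0,\dots,X^n$, a method of moments estimator (MME) is a $\tilde\theta=(\tilde\beta_{i,r})\in\mathbb R^{2p}$ solving, with $\tilde\alpha_{r,i,j}=e^{\tilde\beta_{i,r}+\tilde\beta_{j,r}}$,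 for all $i=1,\dots,p$, $$\frac1n\sum_{t=1}^n\sum_{j\ne i}X^t_{i,j}-\sum_{j\ne i}\frac{\tilde\alpha_{0,i,j}}{1+\tilde\alpha_{0,i,j}}=0,\qquad \sum_{t=1}^n\sum_{j\ne i}\Big\{X^t_{i,j}X^{t-1}_{i,j}-\frac{\tilde\alpha_{0,i,j}}{1+\tilde\alpha_{0,i,j}}\Big(1-\frac1{1+\tilde\alpha_{0,i,j}+\tilde\alpha_{1,i,j}}\Big)\Big\}=0.$$ \textbf{Corollary.} Let $\{X^t\}\sim P_{\theta^*}$, where $n\ge 2$, $p\ge 3$ and $\theta^*=\theta^*_{n,p}$ may vary with $(n,p)$. Assume that there are constants $K$ and $C_\kappa>0$, and numbers $\kappa_0,\kappa_1$ that may vary with $(n,p)$, such that for all $i$ $$\beta^*_{i,1}-\max(\beta^*_{i,0},0)<K,\qquad |\beta^*_{i,1}|\le\kappa_1,\qquad -\kappa_0\le\beta^*_{i,0}\le C_\kappa .$$ Then, as $np\to\infty$, with probability tending to one there is at most one MME. If moreover $\kappa_0+2\kappa_1<c\log(np)$ for all large enough $np$, for some constant $c<1/12$, then with probability tending to one the MME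 $\tilde\theta$ exists and is unique, and $$\|\tilde\theta-\theta^*\|_\infty=O_p\Big(e^{4\kappa_0+6\kappa_1}\sqrt{\tfrac{\log(n)\log(p)}{np}}\Big),$$ that is, for every $\delta>0$ there is $M>0$ such that for all large enough $np$, with probability at least $1-\delta$, the MME exists, is unique, and $\|\tilde\theta-\theta^*\|_\infty\le M e^{4\kappa_0+6\kappa_1}\sqrt{\log(n)\log(p)/(np)}$. -/

import Mathlib

open MeasureTheory ProbabilityTheory Filter Topology

/-- Parameters of the two-way heterogeneity model on `p` nodes: `θ r i` is `β_{i,r}`, so `θ 0` is the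
static heterogeneity vector and `θ 1` the dynamic one.  The norm of this type is
`max_{r, i} |θ r i|`, the `ℓ_∞` norm of the vector of all `2 p` parameters. -/
abbrev TWHMParam (p : ℕ) : Type := Fin 2 → Fin p → ℝ

/-- The set of pairs of nodes `(i, j)` with `i < j`. -/
abbrev NodePair (p : ℕ) : Type := {e : Fin p × Fin p // e.1 < e.2}

/-- `α_{r,i,j} = exp (β_{i,r} + β_{j,r})`. -/
noncomputable def edgeWeight {p : ℕ} (θ : TWHMParam p) (r : Fin 2) (i j : Fin p) : ℝ :=
  Real.exp (θ r i + θ r j)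

/-- The process `X t i j` (`t = 0, 1, 2, …`), driven by the innovations `ε t i j` (`t ≥ 1`), is a
stationary two-way heterogeneity model with parameter `θ` under the probability measure `P`. -/
structure IsStationaryTWHM {p : ℕ} {Ω : Type*} [MeasurableSpace Ω] (P : Measure Ω)
    (θ : TWHMParam p) (ε X : ℕ → Fin p → Fin p → Ω → ℤ) : Prop where
  /-- undirected networks -/
  symm : ∀ t i j ω, X t i j ω = X t j i ω
  /-- no self-loops -/
  diag : ∀ t i ω, X t i i ω = 0
  measurable_init : ∀ i j, i < j → Measurable (X 0 i j)
  measurable_innov : ∀ t i j, 1 ≤ t → i < j → Measurable (ε t i j)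
  /-- the initial edges `X 0 i j` and the innovations `ε t i j`, `t ≥ 1`, over all pairs `i < j`,
  are mutually independent -/
  indep : iIndepFun
    (fun (q : ℕ × NodePair p) (ω : Ω) =>
      if q.1 = 0 then X 0 q.2.1.1 q.2.1.2 ω else ε q.1 q.2.1.1 q.2.1.2 ω) P
  innov_zero : ∀ t i j, 1 ≤ t → i < j → P {ω | ε t i j ω = 0} =
    ENNReal.ofReal (edgeWeight θ 0 i j / (1 + edgeWeight θ 0 i j + edgeWeight θ 1 i j))
  innov_one : ∀ t i j, 1 ≤ t → i < j → P {ω | ε t i j ω = 1} =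
    ENNReal.ofReal (edgeWeight θ 1 i j / (1 + edgeWeight θ 0 i j + edgeWeight θ 1 i j))
  innov_neg_one : ∀ t i j, 1 ≤ t → i < j → P {ω | ε t i j ω = -1} =
    ENNReal.ofReal (1 / (1 + edgeWeight θ 0 i j + edgeWeight θ 1 i j))
  /-- the initial network follows the stationary marginal distribution -/
  init_one : ∀ i j, i < j → P {ω | X 0 i j ω = 1} =
    ENNReal.ofReal (edgeWeight θ 0 i j / (1 + edgeWeight θ 0 i j))
  init_zero : ∀ i j, i < j → P {ω | X 0 i j ω = 0} =
    ENNReal.ofReal (1 / (1 + edgeWeight θ 0 i j))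
  /-- `X^t = I(ε^t = 0) + X^{t-1} I(ε^t = 1)` for `t ≥ 1` -/
  step : ∀ t i j, i < j → ∀ ω, X (t + 1) i j ω =
    (if ε (t + 1) i j ω = 0 then 1 else 0) + X t i j ω * (if ε (t + 1) i j ω = 1 then 1 else 0)

/-- The first set of moment equations, for the static part `θ 0`, from the observed networks
`x 0, …, x n`. -/
def MomentEq₀ {p : ℕ} (n : ℕ) (x : ℕ → Fin p → Fin p → ℤ) (θ : TWHMParam p) : Prop :=
  ∀ i : Fin p,
    (∑ t ∈ Finset.Icc 1 n, ∑ j ∈ Finset.univ.erase i, (x t i j : ℝ)) / (n : ℝ)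
      - ∑ j ∈ Finset.univ.erase i, edgeWeight θ 0 i j / (1 + edgeWeight θ 0 i j) = 0

/-- The second set of moment equations, for the dynamic part `θ 1` given the static part `θ 0`. -/
def MomentEq₁ {p : ℕ} (n : ℕ) (x : ℕ → Fin p → Fin p → ℤ) (θ : TWHMParam p) : Prop :=
  ∀ i : Fin p,
    ∑ t ∈ Finset.Icc 1 n, ∑ j ∈ Finset.univ.erase i,
      ((x t i j : ℝ) * (x (t - 1) i j : ℝ)
        - edgeWeight θ 0 i j / (1 + edgeWeight θ 0 i j)
          * (1 - 1 / (1 + edgeWeight θ 0 i j + edgeWeight θ 1 i j))) = 0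

/-- `θ` is a method of moments estimate computed from the observed networks `x 0, …, x n`. -/
def IsMME {p : ℕ} (n : ℕ) (x : ℕ → Fin p → Fin p → ℤ) (θ : TWHMParam p) : Prop :=
  MomentEq₀ n x θ ∧ MomentEq₁ n x θ

/-! Both sets of moment equations have the form `∑_{j ≠ i} h i j (u i + u j) = d i` with symmetric,
strictly increasing `h i j`. The first involves `θ 0` only; once `θ 0` is fixed, the second is such
a system in `θ 1`. Pairing the difference of two solutions with the difference of their equations
gives a sum of nonnegative terms that vanishes, so the solution is unique for every outcome
(`pairSum_injective`, `IsMME.unique`).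

For existence, such a system is the gradient equation of a potential. The potential is minimised
over a sup-norm ball around the true parameter. Even at a boundary minimiser the gradient has a
definite sign in each coordinate, and this suffices for the sup-norm stability bound
`abs_le_of_pairSum`: if all slopes are at least `m` and the equations at the truth fail by at most
`s`, the minimiser has norm at most `4 s / (m (p - 2))`. If this is smaller than the radius, the
minimiser is interior and solves the system (`exists_pairSum_eq`).

The defect is random. One edge is a two-state Markov chain with conditional mean `a + ρ Y`, so its
time sums are a martingale with bounded increments plus boundary terms, divided by `1 - ρ`. This
makes them sub-Gaussian with proxy of order `n`. Edges at a node are independent, which gives order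
`n p` per node, and a union bound gives a defect of order `q = √(log p / (n p))` per observation,
uniformly over nodes.

In `exists_isMME_near` the static step costs `e^{2κ₀}` and the dynamic step, which inherits the
static error, another `e^{2κ₀ + 2κ₁}`. The error is `O(q e^{4κ₀ + 2κ₁})`, within the asserted rate.
As `4κ₀ + 2κ₁ ≤ 4(κ₀ + 2κ₁)`, the condition `c < 1/12` bounds the exponential by `(n p)^{1/3}`, so
the error tends to zero and the local analysis applies. -/

/-! ### Pair-sum systems: uniqueness, sup-norm stability, existence. -/

theorem sum_sum_erase_comm {p : ℕ} (F : Fin p → Fin p → ℝ) :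
    ∑ i, ∑ j ∈ Finset.univ.erase i, F i j = ∑ i, ∑ j ∈ Finset.univ.erase i, F j i := by
  apply Finset.sum_comm'
  intro x y
  simp [eq_comm]

/-- A triangle `i, j, k` recovers `u i` from its three pair sums; two nodes would only determine the
sum. This is where uniqueness needs `3 ≤ p`. -/
theorem eq_zero_of_pairwise_add_eq_zero {p : ℕ} (hp : 3 ≤ p) (u : Fin p → ℝ)
    (h : ∀ i j, i ≠ j → u i + u j = 0) (i : Fin p) : u i = 0 := by
  obtain ⟨j, hj⟩ : ∃ j, j ∉ ({i} : Finset (Fin p)) := by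
    by_contra! hc
    have := Finset.card_le_card (fun x _ => hc x : (Finset.univ : Finset (Fin p)) ⊆ {i})
    simp at this; omega
  obtain ⟨k, hk⟩ : ∃ k, k ∉ ({i, j} : Finset (Fin p)) := by
    by_contra! hc
    have := Finset.card_le_card (fun x _ => hc x : (Finset.univ : Finset (Fin p)) ⊆ {i, j})
    have h2 := Finset.card_le_two (a := i) (b := j)
    simp at this; omega
  simp only [Finset.mem_insert, Finset.mem_singleton, not_or] at hj hk
  have h1 := h i j (Ne.symm hj)
  have h2 := h i k (Ne.symm hk.1)
  have h3 := h j k (Ne.symm hk.2)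
  linarith

/-- A symmetric system `∑_{j ≠ i} h i j (u i + u j) = d i` with strictly increasing `h i j` has at
most one solution. -/
theorem pairSum_injective {p : ℕ} (hp : 3 ≤ p) (h : Fin p → Fin p → ℝ → ℝ)
    (hsymm : ∀ i j, h i j = h j i) (hmono : ∀ i j, i ≠ j → StrictMono (h i j))
    (u v : Fin p → ℝ)
    (huv : ∀ i, ∑ j ∈ Finset.univ.erase i, h i j (u i + u j)
      = ∑ j ∈ Finset.univ.erase i, h i j (v i + v j)) : u = v := by
  set D : Fin p → Fin p → ℝ := fun i j => h i j (u i + u j) - h i j (v i + v j) with hD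
  have h0 : ∑ i, ∑ j ∈ Finset.univ.erase i, (u i - v i) * D i j = 0 := by
    apply Finset.sum_eq_zero
    intro i _
    rw [← Finset.mul_sum, hD]
    simp only [Finset.sum_sub_distrib, huv i, sub_self, mul_zero]
  have hDs : ∀ i j, D j i = D i j := by
    intro i j
    simp only [hD, hsymm j i, add_comm (u j), add_comm (v j)]
  have h1 : ∑ i, ∑ j ∈ Finset.univ.erase i, (u j - v j) * D i j = 0 := by
    rw [sum_sum_erase_comm]
    simpa only [hDs] using h0
  have hnn : ∀ i j, i ≠ j → 0 ≤ ((u i + u j) - (v i + v j)) * D i j := by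
    intro i j hij
    rcases le_total (v i + v j) (u i + u j) with hle | hle
    · exact mul_nonneg (by linarith) (sub_nonneg.2 ((hmono i j hij).monotone hle))
    · exact mul_nonneg_of_nonpos_of_nonpos (by linarith)
        (sub_nonpos.2 ((hmono i j hij).monotone hle))
  -- Symmetrising turns the pairing with `u i - v i` into one with pair sums, where each term is
  -- nonnegative by monotonicity.
  have h2 : ∑ i, ∑ j ∈ Finset.univ.erase i, ((u i + u j) - (v i + v j)) * D i j = 0 := by
    rw [← add_zero (0 : ℝ)]
    nth_rewrite 2 [← h0]
    rw [← h1, ← Finset.sum_add_distrib]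
    refine Finset.sum_congr rfl fun i _ => ?_
    rw [← Finset.sum_add_distrib]
    exact Finset.sum_congr rfl fun j _ => by ring
  have h3 : ∀ i j, i ≠ j → ((u i + u j) - (v i + v j)) * D i j = 0 := by
    intro i j hij
    rw [Finset.sum_eq_zero_iff_of_nonneg] at h2
    · have h4 := h2 i (Finset.mem_univ _)
      rw [Finset.sum_eq_zero_iff_of_nonneg] at h4
      · exact h4 j (by simp [hij.symm])
      · intro j hj
        exact hnn i j (by simpa [eq_comm] using hj)
    · intro i _
      exact Finset.sum_nonneg fun j hj => hnn i j (by simpa [eq_comm] using hj)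
  have h5 : ∀ i j, i ≠ j → (u i - v i) + (u j - v j) = 0 := by
    intro i j hij
    rcases mul_eq_zero.1 (h3 i j hij) with h6 | h6
    · linarith
    · have := (hmono i j hij).injective (sub_eq_zero.1 h6)
      linarith
  funext i
  exact sub_eq_zero.1 (eq_zero_of_pairwise_add_eq_zero hp (fun i => u i - v i) h5 i)

theorem sign_add_sign_mul_nonneg (a b : ℝ) :
    0 ≤ ((SignType.sign a : ℝ) + (SignType.sign b : ℝ)) * (a + b) := by
  rcases lt_trichotomy a 0 with ha | ha | ha <;> rcases lt_trichotomy b 0 with hb | hb | hb <;>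
    simp [ha, hb] <;> nlinarith

theorem sum_erase_add {p : ℕ} (u : Fin p → ℝ) (i : Fin p) :
    ∑ j ∈ Finset.univ.erase i, (u i + u j) = ((p : ℝ) - 2) * u i + ∑ j, u j := by
  rw [Finset.sum_erase_eq_sub (Finset.mem_univ i), Finset.sum_add_distrib]
  simp
  ring

/-- In row `i₀` every `u i₀ + u j` is nonnegative, so weights may be lowered to `m` (`key1`); this
settles the case `∑ u > 0`. Otherwise `∑ u` must be bounded below. If most signs are positive, few
entries can be near `-U` (`key3`). If not, summing all rows against their signs and symmetrising
again allows weights to be lowered to `m`, which bounds `∑ |u|` (`key2`). -/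
theorem le_of_pairSum_of_isMax {p : ℕ} (hp : 3 ≤ p) (w : Fin p → Fin p → ℝ)
    (hsymm : ∀ i j, w i j = w j i) {m s : ℝ} (hm : 0 < m) (hw : ∀ i j, i ≠ j → m ≤ w i j)
    (u : Fin p → ℝ)
    (hs : ∀ i, (SignType.sign (u i) : ℝ) * ∑ j ∈ Finset.univ.erase i, w i j * (u i + u j) ≤ s)
    (i₀ : Fin p) (hpos : 0 < u i₀) (hmax : ∀ j, |u j| ≤ u i₀) :
    u i₀ ≤ 4 * s / (m * ((p : ℝ) - 2)) := by
  have hp' : (3 : ℝ) ≤ p := by exact_mod_cast hp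
  set U := u i₀ with hU
  set σ : Fin p → ℝ := fun i => (SignType.sign (u i) : ℝ) with hσ
  have key1 : m * (((p : ℝ) - 2) * U + ∑ j, u j) ≤ s := by
    have h1 := hs i₀
    rw [← hU, sign_pos hpos] at h1
    simp only [SignType.coe_one, one_mul] at h1
    rw [hU, ← sum_erase_add, Finset.mul_sum]
    refine le_trans (Finset.sum_le_sum fun j hj => ?_) h1
    have h2 := (abs_le.1 (hmax j)).1
    exact mul_le_mul_of_nonneg_right (hw i₀ j (by simpa [eq_comm] using hj)) (by linarith)
  have hs0 : 0 ≤ s := by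
    refine le_trans ?_ (hs i₀)
    rw [← hU, sign_pos hpos]
    simp only [SignType.coe_one, one_mul]
    refine Finset.sum_nonneg fun j hj => mul_nonneg
      (hm.le.trans (hw i₀ j (by simpa [eq_comm] using hj))) ?_
    have h2 := (abs_le.1 (hmax j)).1
    linarith
  have key2 : m * (((p : ℝ) - 2) * ∑ i, |u i| + (∑ i, σ i) * ∑ i, u i) ≤ p * s := by
    have e1 : ∀ v : Fin p → Fin p → ℝ, (∀ i j, v i j = v j i) →
        ∑ i, σ i * ∑ j ∈ Finset.univ.erase i, v i j * (u i + u j)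
        = (∑ i, ∑ j ∈ Finset.univ.erase i, v i j * ((σ i + σ j) * (u i + u j))) / 2 := by
      intro v hv
      have e2 : ∑ i, ∑ j ∈ Finset.univ.erase i, σ i * (v i j * (u i + u j))
          = ∑ i, ∑ j ∈ Finset.univ.erase i, σ j * (v i j * (u i + u j)) := by
        rw [sum_sum_erase_comm]
        refine Finset.sum_congr rfl fun i _ => Finset.sum_congr rfl fun j _ => ?_
        rw [hv j i, add_comm (u j)]
      simp_rw [Finset.mul_sum]
      rw [eq_div_iff (by norm_num), mul_two]
      nth_rewrite 2 [e2]
      rw [← Finset.sum_add_distrib]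
      refine Finset.sum_congr rfl fun i _ => ?_
      rw [← Finset.sum_add_distrib]
      exact Finset.sum_congr rfl fun j _ => by ring
    have e3 : m * (((p : ℝ) - 2) * ∑ i, |u i| + (∑ i, σ i) * ∑ i, u i)
        = ∑ i, σ i * ∑ j ∈ Finset.univ.erase i, m * (u i + u j) := by
      simp_rw [← Finset.mul_sum, sum_erase_add, mul_add]
      rw [Finset.sum_add_distrib, Finset.sum_mul, Finset.mul_sum, Finset.mul_sum, Finset.mul_sum]
      congr 1
      · refine Finset.sum_congr rfl fun i _ => ?_
        rw [← sign_mul_self (u i)]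
        ring
      · exact Finset.sum_congr rfl fun i _ => by ring
    rw [e3]
    calc _ ≤ ∑ i, σ i * ∑ j ∈ Finset.univ.erase i, w i j * (u i + u j) := by
          rw [e1 _ (fun _ _ => rfl), e1 _ hsymm]
          refine div_le_div_of_nonneg_right (Finset.sum_le_sum fun i _ =>
            Finset.sum_le_sum fun j hj => ?_) (by norm_num)
          exact mul_le_mul_of_nonneg_right (hw i j (by simpa [eq_comm] using hj))
            (sign_add_sign_mul_nonneg _ _)
      _ ≤ ∑ _i : Fin p, s := Finset.sum_le_sum fun i _ => hs i
      _ = p * s := by simp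
  have key3 : U + U / 2 * (∑ i, σ i - p) ≤ ∑ i, u i := by
    have e4 : U + U / 2 * (∑ i, σ i - p) = ∑ i, ((if i = i₀ then U else 0) + U / 2 * (σ i - 1)) := by
      rw [Finset.sum_add_distrib, ← Finset.mul_sum, Finset.sum_sub_distrib]
      simp
    rw [e4]
    refine Finset.sum_le_sum fun i _ => ?_
    have h2 := abs_le.1 (hmax i)
    by_cases hi : i = i₀
    · subst hi
      simp only [hσ, ← hU, sign_pos hpos]
      simp
    · rw [if_neg hi]
      rcases lt_trichotomy (u i) 0 with ha | ha | ha <;> simp [hσ, ha] <;> linarith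
  have habs : -∑ i, u i ≤ ∑ i, |u i| := by
    rw [← Finset.sum_neg_distrib]
    exact Finset.sum_le_sum fun i _ => neg_le_abs _
  rw [le_div_iff₀ (mul_pos hm (by linarith))]
  have hp2 : 0 < (p : ℝ) - 2 := by linarith
  by_cases hu : 0 < ∑ i, u i
  · have : 0 < m * ∑ i, u i := mul_pos hm hu
    nlinarith
  · push Not at hu
    by_cases hσs : ∑ i, σ i ≤ 0
    · have h6 : 0 ≤ (∑ i, σ i) * ∑ i, u i := mul_nonneg_of_nonpos_of_nonpos hσs hu
      have h7 : m * (((p : ℝ) - 2) * ∑ i, |u i|) ≤ p * s :=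
        le_trans (mul_le_mul_of_nonneg_left (by linarith) hm.le) key2
      have h8 : m * (-∑ i, u i) ≤ m * ∑ i, |u i| := mul_le_mul_of_nonneg_left habs hm.le
      have h9 : m * (((p : ℝ) - 2) * U) - s ≤ m * ∑ i, |u i| := by linarith
      have h10 : (p - 2) * (m * (((p : ℝ) - 2) * U) - s) ≤ (p - 2) * (m * ∑ i, |u i|) :=
        mul_le_mul_of_nonneg_left h9 hp2.le
      -- The constant 4 comes from `2 p - 2 ≤ 4 (p - 2)`, that is `3 ≤ p`.
      have h11 : ((p : ℝ) - 2) * (m * (((p : ℝ) - 2) * U)) ≤ ((p : ℝ) - 2) * (4 * s) := by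
        nlinarith
      have := le_of_mul_le_mul_left h11 hp2
      linarith
    · push Not at hσs
      have h12 : 0 ≤ m * (U * ∑ i, σ i) := by positivity
      have h13 : m * (U + U / 2 * (∑ i, σ i - p)) ≤ m * ∑ i, u i :=
        mul_le_mul_of_nonneg_left key3 hm.le
      nlinarith

/-- Sup-norm stability of diagonally balanced symmetric positive systems: the bound depends on the
smallest weight only. -/
theorem abs_le_of_pairSum {p : ℕ} (hp : 3 ≤ p) (w : Fin p → Fin p → ℝ)
    (hsymm : ∀ i j, w i j = w j i) {m s : ℝ} (hm : 0 < m) (hw : ∀ i j, i ≠ j → m ≤ w i j)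
    (hs0 : 0 ≤ s) (u : Fin p → ℝ)
    (hs : ∀ i, (SignType.sign (u i) : ℝ) * ∑ j ∈ Finset.univ.erase i, w i j * (u i + u j) ≤ s)
    (i : Fin p) : |u i| ≤ 4 * s / (m * ((p : ℝ) - 2)) := by
  have hp' : (3 : ℝ) ≤ p := by exact_mod_cast hp
  obtain ⟨i₀, -, hi₀⟩ := Finset.exists_max_image Finset.univ (fun i => |u i|) ⟨i, Finset.mem_univ i⟩
  refine (hi₀ i (Finset.mem_univ i)).trans ?_
  rcases lt_trichotomy (u i₀) 0 with h | h | h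
  · have := le_of_pairSum_of_isMax hp w hsymm hm hw (fun i => -u i) (s := s) (fun i => ?_) i₀
      (by linarith) (fun j => by
        have := hi₀ j (Finset.mem_univ j)
        simpa [abs_of_neg h] using this)
    · rwa [abs_of_neg h]
    · have h1 := hs i
      have h2 : ∑ j ∈ Finset.univ.erase i, w i j * (-u i + -u j)
          = -∑ j ∈ Finset.univ.erase i, w i j * (u i + u j) := by
        rw [← Finset.sum_neg_distrib]
        exact Finset.sum_congr rfl fun j _ => by ring
      rw [h2, Left.sign_neg, SignType.coe_neg, neg_mul_neg]
      exact h1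
  · rw [h, abs_zero]
    have : 0 < m * ((p : ℝ) - 2) := mul_pos hm (by linarith)
    positivity
  · have := le_of_pairSum_of_isMax hp w hsymm hm hw u hs i₀ h (fun j => by
      have := hi₀ j (Finset.mem_univ j)
      simpa [abs_of_pos h] using this)
    rwa [abs_of_pos h]

/-- One-sided, because the minimiser may lie on the boundary of the ball, where only inward moves
are allowed. -/
theorem HasDerivAt.nonneg_of_forall_le {g : ℝ → ℝ} {D ε : ℝ} (hg : HasDerivAt g D 0) (hε : 0 < ε)
    (h : ∀ t, 0 < t → t < ε → g 0 ≤ g t) : 0 ≤ D := by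
  have h1 : Tendsto (slope g 0) (𝓝[Set.Ioi 0] 0) (𝓝 D) :=
    (hasDerivWithinAt_iff_tendsto_slope' (by simp)).1 hg.hasDerivWithinAt
  refine ge_of_tendsto h1 ?_
  filter_upwards [Ioo_mem_nhdsGT hε] with t ht
  rw [slope_def_field]
  exact div_nonneg (sub_nonneg.2 (h t ht.1 ht.2)) (by linarith [ht.1])

/-- Existence of a solution of `∑_{j ≠ i} h i j (u i + u j) = d i` near `0`, from an approximate
solution at `0` and a lower bound on the slopes. -/
theorem exists_pairSum_eq {p : ℕ} (hp : 3 ≤ p) (h : Fin p → Fin p → ℝ → ℝ)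
    (hsymm : ∀ i j, h i j = h j i) (hcont : ∀ i j, Continuous (h i j)) (d : Fin p → ℝ)
    {m s r : ℝ} (hm : 0 < m) (hr : 0 < r)
    (hslope : ∀ i j, i ≠ j → ∀ y, |y| ≤ 2 * r → m * y ^ 2 ≤ (h i j y - h i j 0) * y)
    (hs : ∀ i, |d i - ∑ j ∈ Finset.univ.erase i, h i j 0| ≤ s)
    (hsr : 4 * s / (m * ((p : ℝ) - 2)) < r) :
    ∃ u : Fin p → ℝ, (∀ i, |u i| ≤ 4 * s / (m * ((p : ℝ) - 2))) ∧
      ∀ i, ∑ j ∈ Finset.univ.erase i, h i j (u i + u j) = d i := by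
  have hs0 : 0 ≤ s := (abs_nonneg _).trans (hs ⟨0, by omega⟩)
  set H : Fin p → Fin p → ℝ → ℝ := fun i j x => ∫ t in (0 : ℝ)..x, h i j t with hH
  have hHd : ∀ i j x, HasDerivAt (H i j) (h i j x) x := fun i j x =>
    intervalIntegral.integral_hasDerivAt_right ((hcont i j).intervalIntegrable _ _)
      ((hcont i j).stronglyMeasurableAtFilter _ _) (hcont i j).continuousAt
  have hHc : ∀ i j, Continuous (H i j) := fun i j =>
    continuous_iff_continuousAt.2 fun x => (hHd i j x).continuousAt
  -- The half compensates for counting each unordered pair twice, so the gradient is the defect `G`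
  -- below.
  set Φ : (Fin p → ℝ) → ℝ := fun u =>
    (∑ i, ∑ j ∈ Finset.univ.erase i, H i j (u i + u j)) / 2 - ∑ i, d i * u i with hΦ
  have hΦc : Continuous Φ := by
    have := hHc
    fun_prop
  obtain ⟨u, hu, hmin⟩ := (isCompact_closedBall (0 : Fin p → ℝ) r).exists_isMinOn
    ⟨0, Metric.mem_closedBall_self hr.le⟩ hΦc.continuousOn
  have hur : ∀ i, |u i| ≤ r := by
    rw [mem_closedBall_zero_iff, pi_norm_le_iff_of_nonneg hr.le] at hu
    exact hu
  set G : Fin p → ℝ := fun i => ∑ j ∈ Finset.univ.erase i, h i j (u i + u j) - d i with hG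
  have hder : ∀ (i : Fin p) (c : ℝ),
      HasDerivAt (fun t => Φ (fun a => u a + t * (c * (if a = i then 1 else 0)))) (c * G i) 0 := by
    intro i c
    have hlin : ∀ a : Fin p, HasDerivAt (fun t : ℝ => u a + t * (c * (if a = i then 1 else 0)))
        (c * (if a = i then 1 else 0)) 0 := fun a => by
      simpa using ((hasDerivAt_id (0 : ℝ)).mul_const (c * (if a = i then 1 else 0))).const_add (u a)
    have h1 : HasDerivAt (fun t => Φ (fun a => u a + t * (c * (if a = i then 1 else 0))))
        ((∑ a, ∑ b ∈ Finset.univ.erase a, h a b (u a + u b) *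
          (c * (if a = i then 1 else 0) + c * (if b = i then 1 else 0))) / 2
          - ∑ a, d a * (c * (if a = i then 1 else 0))) 0 := by
      refine HasDerivAt.sub (HasDerivAt.div_const (HasDerivAt.fun_sum fun a _ =>
        HasDerivAt.fun_sum fun b _ => ?_) 2) (HasDerivAt.fun_sum fun a _ => (hlin a).const_mul (d a))
      have h2 := (hlin a).add (hlin b)
      refine HasDerivAt.comp (h₂ := H a b) 0 ?_ h2
      simpa using hHd a b (u a + u b)
    convert h1 using 1
    have h3 : ∑ a, ∑ b ∈ Finset.univ.erase a, h a b (u a + u b) * (c * (if b = i then 1 else 0))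
        = ∑ a, ∑ b ∈ Finset.univ.erase a, h a b (u a + u b) * (c * (if a = i then 1 else 0)) := by
      rw [sum_sum_erase_comm]
      refine Finset.sum_congr rfl fun a _ => Finset.sum_congr rfl fun b _ => ?_
      rw [hsymm b a, add_comm (u b)]
    have h4 : ∑ a, ∑ b ∈ Finset.univ.erase a, h a b (u a + u b) * (c * (if a = i then 1 else 0))
        = c * ∑ b ∈ Finset.univ.erase i, h i b (u i + u b) := by
      simp_rw [← Finset.sum_mul]
      rw [Finset.sum_eq_single i]
      · simp [mul_comm]
      · intro b _ hb
        simp [hb]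
      · simp
    simp_rw [mul_add, Finset.sum_add_distrib]
    rw [h3, h4]
    simp [hG]
    ring
  -- Moving a coordinate towards zero never leaves the ball, so `sign (u i) * G i ≤ 0` holds even on
  -- the boundary.
  have hdir : ∀ (i : Fin p) (c : ℝ), (∃ ε > 0, ∀ t, 0 < t → t < ε → |u i + t * c| ≤ r) →
      0 ≤ c * G i := by
    rintro i c ⟨ε, hε, ht⟩
    refine (hder i c).nonneg_of_forall_le hε fun t h0 h1 => ?_
    have h2 : (fun a => u a + t * (c * (if a = i then 1 else 0))) ∈
        Metric.closedBall (0 : Fin p → ℝ) r := by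
      rw [mem_closedBall_zero_iff, pi_norm_le_iff_of_nonneg hr.le]
      intro a
      by_cases ha : a = i
      · subst ha
        simpa using ht t h0 h1
      · simpa [ha] using hur a
    simpa using hmin h2
  have hbound : ∀ i, |u i| ≤ 4 * s / (m * ((p : ℝ) - 2)) := by
    -- Secant slopes turn the system into a weighted linear one; where the secant is undefined, `m`
    -- is a harmless admissible weight.
    set w : Fin p → Fin p → ℝ := fun i j =>
      if u i + u j = 0 then m else (h i j (u i + u j) - h i j 0) / (u i + u j) with hwdef
    have hwy : ∀ i j, w i j * (u i + u j) = h i j (u i + u j) - h i j 0 := by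
      intro i j
      by_cases h0 : u i + u j = 0
      · simp [h0]
      · simp only [hwdef, if_neg h0]
        field_simp
    refine abs_le_of_pairSum hp w ?_ hm ?_ hs0 u ?_
    · intro i j
      simp only [hwdef, hsymm i j, add_comm (u i)]
    · intro i j hij
      by_cases h0 : u i + u j = 0
      · simp [hwdef, h0]
      · have h1 := hslope i j hij (u i + u j)
          ((abs_add_le _ _).trans (by linarith [hur i, hur j]))
        simp only [hwdef, if_neg h0]
        rw [← mul_div_mul_right _ _ h0, ← sq, le_div_iff₀ (by positivity)]
        exact h1
    · intro i
      simp_rw [hwy, Finset.sum_sub_distrib]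
      have h1 := abs_le.1 (hs i)
      rcases lt_trichotomy (u i) 0 with h0 | h0 | h0
      · have h2 := hdir i 1 ⟨-u i, by linarith, fun t h3 h4 => by
          have := abs_le.1 (hur i)
          rw [abs_le]; constructor <;> linarith⟩
        simp only [hG] at h2
        simp only [sign_neg h0, SignType.coe_neg_one]
        linarith
      · simp [h0, hs0]
      · have h2 := hdir i (-1) ⟨u i, by linarith, fun t h3 h4 => by
          have := abs_le.1 (hur i)
          rw [abs_le]; constructor <;> linarith⟩
        simp only [hG] at h2
        simp only [sign_pos h0, SignType.coe_one]
        linarith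
  refine ⟨u, hbound, fun i => ?_⟩
  have hlt : |u i| < r := (hbound i).trans_lt hsr
  have h1 := hdir i 1 ⟨r - |u i|, by linarith, fun t h3 h4 =>
    (abs_add_le _ _).trans (by rw [mul_one, abs_of_pos h3]; linarith)⟩
  have h2 := hdir i (-1) ⟨r - |u i|, by linarith, fun t h3 h4 =>
    (abs_add_le _ _).trans (by rw [mul_neg_one, abs_neg, abs_of_pos h3]; linarith)⟩
  simp only [hG] at h1 h2
  linarith

/-! ### Sub-Gaussian bounds for a single edge. -/

section SubgaussianCalculus

variable {Ω : Type*} [MeasurableSpace Ω] {P : Measure Ω}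

theorem ProbabilityTheory.HasSubgaussianMGF.weaken {X : Ω → ℝ} {c c' : NNReal}
    (h : HasSubgaussianMGF X c P) (hc : c ≤ c') : HasSubgaussianMGF X c' P where
  integrable_exp_mul := h.integrable_exp_mul
  mgf_le t := (h.mgf_le t).trans (by gcongr)

/-- No independence is assumed, hence `(√c + √c)² = 4 c`; the martingale and its boundary terms are
dependent. -/
theorem ProbabilityTheory.HasSubgaussianMGF.add_same {X Y : Ω → ℝ} {c : NNReal}
    (hX : HasSubgaussianMGF X c P) (hY : HasSubgaussianMGF Y c P) :
    HasSubgaussianMGF (fun ω => X ω + Y ω) (4 * c) P := by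
  have h := hX.add hY
  have h2 : (c.sqrt + c.sqrt) ^ 2 = 4 * c := by
    rw [← two_mul, mul_pow, NNReal.sq_sqrt]
    norm_num
  rwa [h2] at h

theorem ProbabilityTheory.HasSubgaussianMGF.const_mul_le {X : Ω → ℝ} {c c' : NNReal}
    (hX : HasSubgaussianMGF X c P) (r : ℝ) (h : r ^ 2 * c ≤ c') :
    HasSubgaussianMGF (fun ω => r * X ω) c' P := by
  refine (hX.const_mul r).weaken ?_
  rw [← NNReal.coe_le_coe]
  exact h

end SubgaussianCalculus

/-- The trajectory of one edge, as a function of its initial state `w 0` and innovations `w t`. -/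
noncomputable def edgeChain (w : ℕ → ℤ) : ℕ → ℝ
  | 0 => if w 0 = 1 then 1 else 0
  | t + 1 => (if w (t + 1) = 0 then 1 else 0) + edgeChain w t * (if w (t + 1) = 1 then 1 else 0)

theorem edgeChain_eq_zero_or_one (w : ℕ → ℤ) (t : ℕ) :
    edgeChain w t = 0 ∨ edgeChain w t = 1 := by
  induction t with
  | zero => by_cases h : w 0 = 1 <;> simp [edgeChain, h]
  | succ t ih =>
    rcases eq_or_ne (w (t + 1)) 0 with h | h
    · simp [edgeChain, h]
    · by_cases h1 : w (t + 1) = 1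
      · simpa [edgeChain, h1] using ih
      · simp [edgeChain, h, h1]

theorem edgeChain_mem_Icc (w : ℕ → ℤ) (t : ℕ) : edgeChain w t ∈ Set.Icc (0 : ℝ) 1 := by
  rcases edgeChain_eq_zero_or_one w t with h | h <;> simp [h]

theorem edgeChain_congr {w w' : ℕ → ℤ} {t : ℕ} (h : ∀ s ≤ t, w s = w' s) :
    edgeChain w t = edgeChain w' t := by
  induction t with
  | zero => simp [edgeChain, h 0 le_rfl]
  | succ t ih =>
    simp only [edgeChain, h (t + 1) le_rfl, ih fun s hs => h s (hs.trans (Nat.le_succ t))]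

theorem measurable_edgeChain (t : ℕ) : Measurable fun w => edgeChain w t := by
  have h : ∀ (s : ℕ) (z : ℤ), Measurable fun w : ℕ → ℤ => if w s = z then (1 : ℝ) else 0 :=
    fun s z => (measurable_of_countable fun m : ℤ => if m = z then (1 : ℝ) else 0).comp
      (measurable_pi_apply s)
  induction t with
  | zero => exact h 0 1
  | succ t ih => exact (h _ 0).add (ih.mul (h _ 1))

/-- The martingale `∑_{s < t} (c + d Y_s) (Y_{s+1} - a - ρ Y_s)` attached to the edge chain. -/
noncomputable def edgeMartingale (a ρ c d : ℝ) (w : ℕ → ℤ) (t : ℕ) : ℝ :=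
  ∑ s ∈ Finset.range t, (c + d * edgeChain w s) *
    (edgeChain w (s + 1) - a - ρ * edgeChain w s)

theorem edgeMartingale_congr (a ρ c d : ℝ) {w w' : ℕ → ℤ} {t : ℕ} (h : ∀ s ≤ t, w s = w' s) :
    edgeMartingale a ρ c d w t = edgeMartingale a ρ c d w' t := by
  refine Finset.sum_congr rfl fun s hs => ?_
  have hs' := Finset.mem_range.1 hs
  rw [edgeChain_congr (w := w) (w' := w') (t := s) fun r hr => h r (by omega),
    edgeChain_congr (w := w) (w' := w') (t := s + 1) fun r hr => h r (by omega)]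

theorem measurable_edgeMartingale (a ρ c d : ℝ) (t : ℕ) :
    Measurable fun w => edgeMartingale a ρ c d w t := by
  unfold edgeMartingale
  have := measurable_edgeChain
  fun_prop

theorem abs_edgeMartingale_le (a ρ c d : ℝ) (w : ℕ → ℤ) (t : ℕ) :
    |edgeMartingale a ρ c d w t| ≤ t * ((|c| + |d|) * (1 + |a| + |ρ|)) := by
  refine (Finset.abs_sum_le_sum_abs _ _).trans ?_
  refine (Finset.sum_le_card_nsmul _ _ ((|c| + |d|) * (1 + |a| + |ρ|)) fun s _ => ?_).trans
    (by simp)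
  have h1 := edgeChain_mem_Icc w s
  have h2 := edgeChain_mem_Icc w (s + 1)
  have h1' : |edgeChain w s| ≤ 1 := abs_le.2 ⟨by linarith [h1.1], h1.2⟩
  have h2' : |edgeChain w (s + 1)| ≤ 1 := abs_le.2 ⟨by linarith [h2.1], h2.2⟩
  rw [abs_mul]
  refine mul_le_mul ((abs_add_le _ _).trans ?_) ((abs_sub _ _).trans ?_) (abs_nonneg _)
    (by positivity)
  · rw [abs_mul]
    nlinarith [abs_nonneg d]
  · rw [abs_mul]
    have := abs_sub (edgeChain w (s + 1)) a
    nlinarith [abs_nonneg ρ]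

/-- The innovations of one edge: independent, with the initial state of mean `π` and with the
transition `E[Y_{t+1} | Y_t] = a + ρ Y_t`, for which `π` is stationary. -/
structure EdgeDriver {Ω : Type*} [MeasurableSpace Ω] (P : Measure Ω) (W : ℕ → Ω → ℤ)
    (μ a ρ : ℝ) : Prop where
  measurable : ∀ t, Measurable (W t)
  indep : iIndepFun W P
  init : P.real {ω | W 0 ω = 1} = μ
  zero : ∀ t, P.real {ω | W (t + 1) ω = 0} = a
  one : ∀ t, P.real {ω | W (t + 1) ω = 1} = ρ
  stationary : μ * (1 - ρ) = a

namespace EdgeDriver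

variable {Ω : Type*} [MeasurableSpace Ω] {P : Measure Ω} {W : ℕ → Ω → ℤ} {μ a ρ : ℝ}

theorem measurable_path (h : EdgeDriver P W μ a ρ) : Measurable fun ω t => W t ω :=
  measurable_pi_lambda _ h.measurable

theorem indepFun_past (h : EdgeDriver P W μ a ρ) {φ : (ℕ → ℤ) → ℝ} (hφ : Measurable φ) {t : ℕ}
    (hcongr : ∀ w w' : ℕ → ℤ, (∀ s ≤ t, w s = w' s) → φ w = φ w') (ψ : ℤ → ℝ) :
    IndepFun (fun ω => φ fun s => W s ω) (fun ω => ψ (W (t + 1) ω)) P := by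
  have h1 := h.indep.indepFun_finset (Finset.range (t + 1)) {t + 1} (by simp) h.measurable
  -- Padding the finite past with zeros gives a full path; `hcongr` makes the padding irrelevant to
  -- `φ`.
  let ext : (Finset.range (t + 1) → ℤ) → ℕ → ℤ := fun v s =>
    if hs : s ∈ Finset.range (t + 1) then v ⟨s, hs⟩ else 0
  have hext : Measurable ext := by
    refine measurable_pi_lambda _ fun s => ?_
    by_cases hs : s ∈ Finset.range (t + 1)
    · simpa only [ext, dif_pos hs] using measurable_pi_apply _
    · simpa only [ext, dif_neg hs] using measurable_const
  have h2 := h1.comp (hφ.comp hext)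
    ((measurable_of_countable ψ).comp (measurable_pi_apply ⟨t + 1, Finset.mem_singleton_self _⟩))
  have h3 : (fun ω => φ fun s => W s ω) =
      (φ ∘ ext) ∘ fun ω (i : Finset.range (t + 1)) => W i ω := by
    funext ω
    refine hcongr _ _ fun s hs => ?_
    simp only [ext]
    rw [dif_pos (Finset.mem_range.2 (Nat.lt_succ_of_le hs))]
  rw [h3]
  exact h2

theorem integral_indicator (h : EdgeDriver P W μ a ρ) (s : ℕ) (z : ℤ) :
    ∫ ω, (if W s ω = z then (1 : ℝ) else 0) ∂P = P.real {ω | W s ω = z} := by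
  have hm : MeasurableSet {ω | W s ω = z} := h.measurable s (measurableSet_singleton z)
  rw [← integral_indicator_one hm]
  refine integral_congr_ae (ae_of_all _ fun ω => ?_)
  simp [Set.indicator]

theorem measurable_indicator (h : EdgeDriver P W μ a ρ) (s : ℕ) (z : ℤ) :
    Measurable fun ω => (if W s ω = z then (1 : ℝ) else 0) :=
  (measurable_of_countable fun m : ℤ => if m = z then (1 : ℝ) else 0).comp (h.measurable s)

variable [IsProbabilityMeasure P]

theorem integrable_indicator (h : EdgeDriver P W μ a ρ) (s : ℕ) (z : ℤ) :
    Integrable (fun ω => (if W s ω = z then (1 : ℝ) else 0)) P := by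
  refine Integrable.of_mem_Icc 0 1 (h.measurable_indicator s z).aemeasurable
    (ae_of_all _ fun ω => ?_)
  by_cases hz : W s ω = z <;> simp [hz]

theorem integral_edgeChain (h : EdgeDriver P W μ a ρ) (t : ℕ) :
    ∫ ω, edgeChain (fun s => W s ω) t ∂P = μ := by
  induction t with
  | zero => exact (h.integral_indicator 0 1).trans h.init
  | succ t ih =>
    have h1 : IndepFun (fun ω => edgeChain (fun s => W s ω) t)
        (fun ω => (if W (t + 1) ω = 1 then (1 : ℝ) else 0)) P :=
      h.indepFun_past (measurable_edgeChain t) (fun _ _ => edgeChain_congr)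
        (fun z => if z = 1 then (1 : ℝ) else 0)
    have hm : Measurable fun ω => edgeChain (fun s => W s ω) t :=
      (measurable_edgeChain t).comp h.measurable_path
    have h2 := h1.integral_fun_mul_eq_mul_integral hm.aestronglyMeasurable
      (h.measurable_indicator (t + 1) 1).aestronglyMeasurable
    have hi : Integrable (fun ω => edgeChain (fun s => W s ω) t) P :=
      Integrable.of_mem_Icc 0 1 hm.aemeasurable (ae_of_all _ fun ω => edgeChain_mem_Icc _ _)
    have h3 : Integrable (fun ω => edgeChain (fun s => W s ω) t *
        (if W (t + 1) ω = 1 then (1 : ℝ) else 0)) P :=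
      h1.integrable_mul hi (h.integrable_indicator (t + 1) 1)
    simp only [edgeChain]
    rw [integral_add (h.integrable_indicator (t + 1) 0) h3, h2, ih, h.integral_indicator,
      h.integral_indicator, h.zero, h.one, ← h.stationary]
    ring

theorem hasSubgaussianMGF_edgeChain (h : EdgeDriver P W μ a ρ) (t : ℕ) :
    HasSubgaussianMGF (fun ω => edgeChain (fun s => W s ω) t - μ) 1 P := by
  have h1 := hasSubgaussianMGF_of_mem_Icc (μ := P) (a := 0) (b := 1)
    ((measurable_edgeChain t).comp h.measurable_path).aemeasurable
    (ae_of_all _ fun ω => edgeChain_mem_Icc _ t)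
  have h2 := h1.weaken (c' := 1) (by
    rw [← NNReal.coe_le_coe]; norm_num)
  simpa only [Function.comp_def, h.integral_edgeChain t] using h2

theorem mgf_innovation_le (h : EdgeDriver P W μ a ρ) (t : ℕ) (ψ : ℤ → ℝ)
    (hψ : ∀ z, ψ z ∈ Set.Icc (0 : ℝ) 1) (r x : ℝ) (hr : |r| ≤ 1) :
    ∫ ω, Real.exp (x * (r * (ψ (W (t + 1) ω) - ∫ ω', ψ (W (t + 1) ω') ∂P))) ∂P
      ≤ Real.exp (x ^ 2 / 2) := by
  have h1 := hasSubgaussianMGF_of_mem_Icc (μ := P) (a := 0) (b := 1)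
    ((measurable_of_countable ψ).comp (h.measurable (t + 1))).aemeasurable
    (ae_of_all _ fun ω => hψ _)
  have h2 := (h1.const_mul_le r (c' := 1) (by
    have : r ^ 2 ≤ 1 := by rw [← sq_abs]; nlinarith [abs_nonneg r]
    norm_num; linarith)).mgf_le x
  simpa [mgf] using h2

/-- Given the past, the next increment is `c` or `c + d` times a centred `[0, 1]`-valued function of
the new innovation, according to the current state. Either way it multiplies the moment generating
function by at most `exp (x² / 2)`. -/
theorem hasSubgaussianMGF_edgeMartingale (h : EdgeDriver P W μ a ρ) (c d : ℝ) (hc : |c| ≤ 1)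
    (hcd : |c + d| ≤ 1) (t : ℕ) :
    HasSubgaussianMGF (fun ω => edgeMartingale a ρ c d (fun s => W s ω) t) t P := by
  have hmeas : ∀ t, Measurable fun ω => edgeMartingale a ρ c d (fun s => W s ω) t := fun t =>
    (measurable_edgeMartingale a ρ c d t).comp h.measurable_path
  have hYm : ∀ t, Measurable fun ω => edgeChain (fun s => W s ω) t := fun t =>
    (measurable_edgeChain t).comp h.measurable_path
  have hint : ∀ t x, Integrable
      (fun ω => Real.exp (x * edgeMartingale a ρ c d (fun s => W s ω) t)) P := fun t x =>
    integrable_exp_mul_of_mem_Icc (hmeas t).aemeasurable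
      (ae_of_all _ fun ω => abs_le.1 (abs_edgeMartingale_le a ρ c d _ t))
  refine ⟨hint t, fun x => ?_⟩
  induction t with
  | zero => simp [mgf, edgeMartingale]
  | succ t ih =>
    set Z : Ω → ℝ := fun ω => Real.exp (x * edgeMartingale a ρ c d (fun s => W s ω) t) with hZ
    set Y : Ω → ℝ := fun ω => edgeChain (fun s => W s ω) t with hY
    -- `ψ₀` and `ψ₁` are the next state when the current state is 0 and 1; splitting with `1 = (1 -
    -- Y) + Y` separates past from innovation.
    let ψ₀ : ℤ → ℝ := fun z => if z = 0 then 1 else 0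
    let ψ₁ : ℤ → ℝ := fun z => (if z = 0 then 1 else 0) + (if z = 1 then 1 else 0)
    have hψ₀ : ∀ z, ψ₀ z ∈ Set.Icc (0 : ℝ) 1 := fun z => by
      by_cases hz : z = 0 <;> simp [ψ₀, hz]
    have hψ₁ : ∀ z, ψ₁ z ∈ Set.Icc (0 : ℝ) 1 := fun z => by
      by_cases hz : z = 0
      · simp [ψ₁, hz]
      · by_cases hz1 : z = 1 <;> simp [ψ₁, hz, hz1]
    have e₀ : ∫ ω, ψ₀ (W (t + 1) ω) ∂P = a := (h.integral_indicator (t + 1) 0).trans (h.zero t)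
    have e₁ : ∫ ω, ψ₁ (W (t + 1) ω) ∂P = a + ρ := by
      simp only [ψ₁]
      rw [integral_add (h.integrable_indicator (t + 1) 0) (h.integrable_indicator (t + 1) 1),
        h.integral_indicator, h.integral_indicator, h.zero, h.one]
    let V₀ : ℤ → ℝ := fun z => Real.exp (x * (c * (ψ₀ z - a)))
    let V₁ : ℤ → ℝ := fun z => Real.exp (x * ((c + d) * (ψ₁ z - (a + ρ))))
    have hV₀ : ∫ ω, V₀ (W (t + 1) ω) ∂P ≤ Real.exp (x ^ 2 / 2) := by
      have := h.mgf_innovation_le t ψ₀ hψ₀ c x hc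
      rwa [e₀] at this
    have hV₁ : ∫ ω, V₁ (W (t + 1) ω) ∂P ≤ Real.exp (x ^ 2 / 2) := by
      have := h.mgf_innovation_le t ψ₁ hψ₁ (c + d) x hcd
      rwa [e₁] at this
    have hV₀i : Integrable (fun ω => V₀ (W (t + 1) ω)) P := by
      refine integrable_exp_mul_of_mem_Icc (a := -(|c| * (1 + |a|))) (b := |c| * (1 + |a|))
        (X := fun ω => c * (ψ₀ (W (t + 1) ω) - a))
        (((measurable_of_countable fun z => c * (ψ₀ z - a)).comp (h.measurable _)).aemeasurable)
        (ae_of_all _ fun ω => abs_le.1 ?_)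
      rw [abs_mul]
      refine mul_le_mul_of_nonneg_left ((abs_sub _ _).trans ?_) (abs_nonneg _)
      have := hψ₀ (W (t + 1) ω)
      rw [abs_of_nonneg this.1]
      linarith [this.2]
    have hV₁i : Integrable (fun ω => V₁ (W (t + 1) ω)) P := by
      refine integrable_exp_mul_of_mem_Icc (a := -(|c + d| * (1 + |a + ρ|)))
        (b := |c + d| * (1 + |a + ρ|))
        (X := fun ω => (c + d) * (ψ₁ (W (t + 1) ω) - (a + ρ)))
        (((measurable_of_countable fun z => (c + d) * (ψ₁ z - (a + ρ))).comp
          (h.measurable _)).aemeasurable)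
        (ae_of_all _ fun ω => abs_le.1 ?_)
      rw [abs_mul]
      refine mul_le_mul_of_nonneg_left ((abs_sub _ _).trans ?_) (abs_nonneg _)
      have := hψ₁ (W (t + 1) ω)
      rw [abs_of_nonneg this.1]
      linarith [this.2]
    have hA₁i : Integrable (fun ω => Y ω * Z ω) P := by
      refine (hint t x).bdd_mul (c := 1) (hYm t).aestronglyMeasurable (ae_of_all _ fun ω => ?_)
      have := edgeChain_mem_Icc (fun s => W s ω) t
      rw [Real.norm_of_nonneg this.1]
      exact this.2
    have hA₀i : Integrable (fun ω => Z ω - Y ω * Z ω) P := (hint t x).sub hA₁i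
    have hi₀ : IndepFun (fun ω => Z ω - Y ω * Z ω) (fun ω => V₀ (W (t + 1) ω)) P := by
      refine h.indepFun_past (φ := fun w => Real.exp (x * edgeMartingale a ρ c d w t)
        - edgeChain w t * Real.exp (x * edgeMartingale a ρ c d w t)) ?_ (fun w w' hw => ?_) V₀
      · have := measurable_edgeChain t
        have := measurable_edgeMartingale a ρ c d t
        fun_prop
      · simp only [edgeChain_congr hw, edgeMartingale_congr a ρ c d hw]
    have hi₁ : IndepFun (fun ω => Y ω * Z ω) (fun ω => V₁ (W (t + 1) ω)) P := by
      refine h.indepFun_past (φ := fun w =>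
        edgeChain w t * Real.exp (x * edgeMartingale a ρ c d w t)) ?_ (fun w w' hw => ?_) V₁
      · have := measurable_edgeChain t
        have := measurable_edgeMartingale a ρ c d t
        fun_prop
      · simp only [edgeChain_congr hw, edgeMartingale_congr a ρ c d hw]
    have hsplit : ∀ ω, Real.exp (x * edgeMartingale a ρ c d (fun s => W s ω) (t + 1))
        = (Z ω - Y ω * Z ω) * V₀ (W (t + 1) ω) + Y ω * Z ω * V₁ (W (t + 1) ω) := by
      intro ω
      have hrec : edgeMartingale a ρ c d (fun s => W s ω) (t + 1)
          = edgeMartingale a ρ c d (fun s => W s ω) t + (c + d * Y ω) *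
            ((if W (t + 1) ω = 0 then 1 else 0) + Y ω * (if W (t + 1) ω = 1 then 1 else 0)
              - a - ρ * Y ω) := by
        rw [edgeMartingale, Finset.sum_range_succ]
        rfl
      rw [hrec, mul_add, Real.exp_add]
      rcases edgeChain_eq_zero_or_one (fun s => W s ω) t with h0 | h0
      · have h0' : Y ω = 0 := h0
        simp only [h0', hZ, V₀, ψ₀]
        ring_nf
      · have h0' : Y ω = 1 := h0
        simp only [h0', hZ, V₁, ψ₁]
        ring_nf
    have hZ0 : ∀ ω, 0 ≤ Y ω * Z ω := fun ω =>
      mul_nonneg (edgeChain_mem_Icc _ _).1 (Real.exp_pos _).le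
    have hZ1 : ∀ ω, 0 ≤ Z ω - Y ω * Z ω := fun ω => by
      have h1 := (edgeChain_mem_Icc (fun s => W s ω) t).2
      have h2 : 0 < Z ω := Real.exp_pos _
      have h3 : Y ω * Z ω ≤ 1 * Z ω := mul_le_mul_of_nonneg_right h1 h2.le
      linarith
    calc mgf (fun ω => edgeMartingale a ρ c d (fun s => W s ω) (t + 1)) P x
        = ∫ ω, ((Z ω - Y ω * Z ω) * V₀ (W (t + 1) ω) + Y ω * Z ω * V₁ (W (t + 1) ω)) ∂P :=
          integral_congr_ae (ae_of_all _ hsplit)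
      _ = (∫ ω, (Z ω - Y ω * Z ω) ∂P) * (∫ ω, V₀ (W (t + 1) ω) ∂P)
          + (∫ ω, Y ω * Z ω ∂P) * ∫ ω, V₁ (W (t + 1) ω) ∂P := by
          rw [← hi₀.integral_fun_mul_eq_mul_integral hA₀i.1 hV₀i.1,
            ← hi₁.integral_fun_mul_eq_mul_integral hA₁i.1 hV₁i.1]
          exact integral_add (hi₀.integrable_mul hA₀i hV₀i) (hi₁.integrable_mul hA₁i hV₁i)
      _ ≤ (∫ ω, (Z ω - Y ω * Z ω) ∂P) * Real.exp (x ^ 2 / 2)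
          + (∫ ω, Y ω * Z ω ∂P) * Real.exp (x ^ 2 / 2) :=
          add_le_add (mul_le_mul_of_nonneg_left hV₀ (integral_nonneg hZ1))
            (mul_le_mul_of_nonneg_left hV₁ (integral_nonneg hZ0))
      _ = mgf (fun ω => edgeMartingale a ρ c d (fun s => W s ω) t) P x * Real.exp (x ^ 2 / 2) := by
          rw [← add_mul, ← integral_add hA₀i hA₁i]
          simp [mgf, hZ]
      _ ≤ Real.exp ((t : NNReal) * x ^ 2 / 2) * Real.exp (x ^ 2 / 2) :=
          mul_le_mul_of_nonneg_right ih (Real.exp_pos _).le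
      _ = Real.exp (((t + 1 : ℕ) : NNReal) * x ^ 2 / 2) := by
          rw [← Real.exp_add]
          congr 1
          push_cast
          ring

end EdgeDriver

theorem sum_edgeChain_shift (w : ℕ → ℤ) (μ : ℝ) (n : ℕ) :
    ∑ t ∈ Finset.range n, (edgeChain w t - μ)
      = ∑ t ∈ Finset.range n, (edgeChain w (t + 1) - μ) + (edgeChain w 0 - μ)
        + (-1) * (edgeChain w n - μ) := by
  have := Finset.sum_range_sub (fun t => edgeChain w t - μ) n
  rw [Finset.sum_sub_distrib] at this
  linarith

/-- With `S` the sum, stationarity gives `M = S - ρ S'`, where the shifted sum `S'` differs from `S`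
by boundary terms only; solve for `S`. -/
theorem sum_edgeChain_eq (w : ℕ → ℤ) {μ a ρ : ℝ} (hstat : μ * (1 - ρ) = a) (hρ : ρ < 1) (n : ℕ) :
    ∑ t ∈ Finset.range n, (edgeChain w (t + 1) - μ)
      = (1 / (1 - ρ)) * (edgeMartingale a ρ 1 0 w n + ρ * (edgeChain w 0 - μ)
        + (-ρ) * (edgeChain w n - μ)) := by
  have h1 : edgeMartingale a ρ 1 0 w n = ∑ t ∈ Finset.range n, (edgeChain w (t + 1) - μ)
      - ρ * ∑ t ∈ Finset.range n, (edgeChain w t - μ) := by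
    rw [Finset.mul_sum, ← Finset.sum_sub_distrib]
    refine Finset.sum_congr rfl fun t _ => ?_
    rw [← hstat]
    ring
  have h2 : 1 - ρ ≠ 0 := by linarith
  rw [h1, sum_edgeChain_shift]
  field_simp
  ring

/-- Uses `Y² = Y`: the predictable weight `Y_t` (`c = 0`, `d = 1`) isolates persistent edges. -/
theorem sum_edgeChain_mul_eq (w : ℕ → ℤ) (μ a ρ : ℝ) (n : ℕ) :
    ∑ t ∈ Finset.range n, (edgeChain w (t + 1) * edgeChain w t - μ * (a + ρ))
      = edgeMartingale a ρ 0 1 w n + (a + ρ) * ∑ t ∈ Finset.range n, (edgeChain w t - μ) := by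
  rw [edgeMartingale, Finset.mul_sum, ← Finset.sum_add_distrib]
  refine Finset.sum_congr rfl fun t _ => ?_
  rcases edgeChain_eq_zero_or_one w t with h | h <;> rw [h] <;> ring

namespace EdgeDriver

variable {Ω : Type*} [MeasurableSpace Ω] {P : Measure Ω} [IsProbabilityMeasure P]
  {W : ℕ → Ω → ℤ} {μ a ρ : ℝ}

theorem hasSubgaussianMGF_const_mul_edgeChain (h : EdgeDriver P W μ a ρ) (t : ℕ) {r : ℝ}
    (hr : |r| ≤ 1) {c : NNReal} (hc : 1 ≤ c) :
    HasSubgaussianMGF (fun ω => r * (edgeChain (fun s => W s ω) t - μ)) c P := by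
  refine (h.hasSubgaussianMGF_edgeChain t).const_mul_le r ?_
  have h1 : r ^ 2 ≤ 1 := by rw [← sq_abs]; nlinarith [abs_nonneg r]
  have h2 : (1 : ℝ) ≤ c := hc
  simp only [NNReal.coe_one, mul_one]
  linarith

theorem hasSubgaussianMGF_sum (h : EdgeDriver P W μ a ρ) (hρ0 : 0 ≤ ρ) (hρ : ρ < 1) {L : NNReal}
    (hL : 1 / (1 - ρ) ≤ L) {n : ℕ} (hn : 1 ≤ n) :
    HasSubgaussianMGF (fun ω => ∑ t ∈ Finset.range n, (edgeChain (fun s => W s ω) (t + 1) - μ))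
      (16 * L ^ 2 * n) P := by
  have hn' : (1 : NNReal) ≤ n := by exact_mod_cast hn
  have h1 := (h.hasSubgaussianMGF_edgeMartingale 1 0 (by simp) (by simp) n).add_same
    (h.hasSubgaussianMGF_const_mul_edgeChain 0 (r := ρ) (by rw [abs_of_nonneg hρ0]; exact hρ.le) hn')
  have h2 := h1.add_same (h.hasSubgaussianMGF_const_mul_edgeChain n (r := -ρ) (c := 4 * n)
    (by rw [abs_neg, abs_of_nonneg hρ0]; exact hρ.le)
    (hn'.trans (le_mul_of_one_le_left (by positivity) (by norm_num))))
  have h3 := h2.const_mul_le (1 / (1 - ρ)) (c' := 16 * L ^ 2 * n) (by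
    push_cast
    have h4 : (1 / (1 - ρ)) ^ 2 ≤ (L : ℝ) ^ 2 :=
      pow_le_pow_left₀ (one_div_nonneg.2 (by linarith)) hL 2
    have h5 : (0 : ℝ) ≤ 4 * (4 * (n : ℝ)) := by positivity
    nlinarith [mul_le_mul_of_nonneg_right h4 h5])
  refine h3.congr (ae_of_all _ fun ω => ?_)
  exact (sum_edgeChain_eq (fun s => W s ω) h.stationary hρ n).symm

theorem hasSubgaussianMGF_sum_mul (h : EdgeDriver P W μ a ρ) (hρ0 : 0 ≤ ρ) (hρ : ρ < 1)
    (ha0 : 0 ≤ a) (haρ : a + ρ ≤ 1) {L : NNReal} (hL : 1 / (1 - ρ) ≤ L) {n : ℕ} (hn : 1 ≤ n) :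
    HasSubgaussianMGF (fun ω => ∑ t ∈ Finset.range n, (edgeChain (fun s => W s ω) (t + 1) *
      edgeChain (fun s => W s ω) t - μ * (a + ρ))) (1024 * L ^ 2 * n) P := by
  have hn' : (1 : NNReal) ≤ n := by exact_mod_cast hn
  have hL1 : (1 : NNReal) ≤ L := by
    rw [← NNReal.coe_le_coe]
    refine le_trans ?_ hL
    rw [NNReal.coe_one, le_div_iff₀ (by linarith)]
    linarith
  have hLn : (1 : NNReal) ≤ L ^ 2 * n := one_le_mul_of_one_le_of_one_le (one_le_pow₀ hL1) hn'
  have hb : ∀ k : NNReal, 1 ≤ k → (1 : NNReal) ≤ k * (L ^ 2 * n) := fun k hk => one_le_mul_of_one_le_of_one_le hk hLn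
  have h1 := (h.hasSubgaussianMGF_sum hρ0 hρ hL hn).add_same
    ((h.hasSubgaussianMGF_edgeChain 0).weaken (c' := 16 * L ^ 2 * n) (by
      rw [mul_assoc]; exact hb 16 (by norm_num)))
  have h2 := h1.add_same (h.hasSubgaussianMGF_const_mul_edgeChain n (r := -1) (by simp)
    (c := 4 * (16 * L ^ 2 * n)) (by
      rw [mul_assoc, ← mul_assoc]; exact hb (4 * 16) (by norm_num)))
  have h3 := h2.const_mul_le (a + ρ) (c' := 4 * (4 * (16 * L ^ 2 * n))) (by
    have h4 : (a + ρ) ^ 2 ≤ 1 := by nlinarith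
    have h5 : (0 : ℝ) ≤ ((4 * (4 * (16 * L ^ 2 * n)) : NNReal) : ℝ) := NNReal.coe_nonneg _
    nlinarith)
  have h6 := ((h.hasSubgaussianMGF_edgeMartingale 0 1 (by simp) (by simp) n).weaken
    (c' := 4 * (4 * (16 * L ^ 2 * n))) (by
      have : (n : NNReal) = 1 * n := (one_mul _).symm
      rw [← mul_assoc, ← mul_assoc, ← mul_assoc]
      nth_rewrite 1 [this]
      refine mul_le_mul_left ?_ _
      exact one_le_mul_of_one_le_of_one_le (by norm_num) (one_le_pow₀ hL1))).add_same h3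
  -- Three dependent additions, each costing a factor 4, on top of 16: two boundary terms and the
  -- martingale.
  have h7 : (4 * (4 * (4 * (16 * L ^ 2 * n))) : NNReal) = 1024 * L ^ 2 * n := by
    ring
  rw [h7] at h6
  refine h6.congr (ae_of_all _ fun ω => ?_)
  simp only
  rw [sum_edgeChain_mul_eq, sum_edgeChain_shift]

end EdgeDriver

/-! ### From independent edges to node statistics. -/

/-- Blocks of an independent family are independent. -/
theorem ProbabilityTheory.iIndepFun.curry {Ω ι κ E : Type*} [MeasurableSpace Ω]
    [MeasurableSpace E] {P : Measure Ω} {X : κ → ι → Ω → E} (hm : ∀ k i, Measurable (X k i))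
    (h : iIndepFun (fun (q : κ × ι) ω => X q.1 q.2 ω) P) :
    iIndepFun (fun i ω k => X k i ω) P := by
  have : IsProbabilityMeasure P := h.isProbabilityMeasure
  have hprob : ∀ i k, IsProbabilityMeasure (P.map (X k i)) := fun i k =>
    Measure.isProbabilityMeasure_map (hm k i).aemeasurable
  have h1 : iIndepFun (fun (q : (_ : ι) × κ) ω => X q.2 q.1 ω) P :=
    h.precomp (g := fun q : (_ : ι) × κ => (q.2, q.1)) (by
      rintro ⟨a, b⟩ ⟨c, d⟩ hq
      simp only [Prod.mk.injEq] at hq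
      simp [hq.1, hq.2])
  have h2 : ∀ i, iIndepFun (fun k => X k i) P := fun i =>
    h.precomp (g := fun k => (k, i)) (by
      intro a b hab
      simpa using hab)
  -- Independence means that the joint law is a product; currying carries the product over pairs to
  -- a product of products.
  have e : (MeasurableEquiv.piCurry fun (_ : ι) (_ : κ) => E) ∘ (fun ω q => X q.2 q.1 ω)
      = fun ω i k => X k i ω := by
    ext; simp [Sigma.curry]
  rw [iIndepFun_iff_map_fun_eq_infinitePi_map (by fun_prop), ← e,
    ← Measure.map_map (by fun_prop) (by fun_prop),
    (iIndepFun_iff_map_fun_eq_infinitePi_map (by fun_prop)).1 h1,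
    Measure.infinitePi_map_piCurry (fun i k => P.map (X k i))]
  congrm Measure.infinitePi fun i => ?_
  rw [(iIndepFun_iff_map_fun_eq_infinitePi_map (by fun_prop)).1 (h2 i)]

theorem edgeWeight_pos {p : ℕ} (θ : TWHMParam p) (r : Fin 2) (i j : Fin p) :
    0 < edgeWeight θ r i j := Real.exp_pos _

theorem edgeWeight_comm {p : ℕ} (θ : TWHMParam p) (r : Fin 2) (i j : Fin p) :
    edgeWeight θ r i j = edgeWeight θ r j i := by
  rw [edgeWeight, edgeWeight, add_comm]

/-- The stationary edge probability. -/
noncomputable def edgeProb {p : ℕ} (θ : TWHMParam p) (i j : Fin p) : ℝ :=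
  edgeWeight θ 0 i j / (1 + edgeWeight θ 0 i j)

/-- The stationary probability of an edge at two consecutive times. -/
noncomputable def edgePairProb {p : ℕ} (θ : TWHMParam p) (i j : Fin p) : ℝ :=
  edgeProb θ i j * (1 - 1 / (1 + edgeWeight θ 0 i j + edgeWeight θ 1 i j))

/-- The unordered pair `{i, j}`. -/
def nodePair {p : ℕ} (i j : Fin p) (h : j ≠ i) : NodePair p :=
  if hij : i < j then ⟨(i, j), hij⟩ else ⟨(j, i), lt_of_le_of_ne (not_lt.1 hij) h⟩

/-- The edges at a fixed node are distinct, so their drivers form an independent subfamily. -/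
theorem nodePair_injective {p : ℕ} (i : Fin p) :
    Function.Injective fun j : {j : Fin p // j ≠ i} => nodePair i j.1 j.2 := by
  rintro ⟨a, ha⟩ ⟨b, hb⟩ h
  simp only [nodePair] at h
  split_ifs at h <;> simp_all

namespace IsStationaryTWHM

variable {p : ℕ} {Ω : Type*} [MeasurableSpace Ω] {P : Measure Ω}
  {θ : TWHMParam p} {ε X : ℕ → Fin p → Fin p → Ω → ℤ}

/-- Initial state and innovations of one edge. -/
def driver (ε X : ℕ → Fin p → Fin p → Ω → ℤ) (e : NodePair p) (t : ℕ) (ω : Ω) : ℤ :=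
  if t = 0 then X 0 e.1.1 e.1.2 ω else ε t e.1.1 e.1.2 ω

theorem measurable_driver (h : IsStationaryTWHM P θ ε X) (e : NodePair p) (t : ℕ) :
    Measurable (driver ε X e t) := by
  unfold driver
  by_cases ht : t = 0
  · simpa [ht] using h.measurable_init _ _ e.2
  · simpa [ht] using h.measurable_innov t _ _ (Nat.one_le_iff_ne_zero.2 ht) e.2

theorem edgeDriver (h : IsStationaryTWHM P θ ε X) (e : NodePair p) :
    EdgeDriver P (driver ε X e) (edgeProb θ e.1.1 e.1.2)
      (edgeWeight θ 0 e.1.1 e.1.2 /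
        (1 + edgeWeight θ 0 e.1.1 e.1.2 + edgeWeight θ 1 e.1.1 e.1.2))
      (edgeWeight θ 1 e.1.1 e.1.2 /
        (1 + edgeWeight θ 0 e.1.1 e.1.2 + edgeWeight θ 1 e.1.1 e.1.2)) := by
  have p0 := edgeWeight_pos θ 0 e.1.1 e.1.2
  have p1 := edgeWeight_pos θ 1 e.1.1 e.1.2
  refine ⟨h.measurable_driver e, ?_, ?_, fun t => ?_, fun t => ?_, ?_⟩
  · exact h.indep.precomp (g := fun t => (t, e)) (fun a b hab => by simpa using hab)
  · have := h.init_one _ _ e.2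
    simp only [driver, if_true, Measure.real]
    rw [this, ENNReal.toReal_ofReal (by positivity)]
    rfl
  · have := h.innov_zero (t + 1) _ _ (by omega) e.2
    simp only [driver, Nat.add_eq_zero_iff, one_ne_zero, and_false, if_false, Measure.real]
    rw [this, ENNReal.toReal_ofReal (by positivity)]
  · have := h.innov_one (t + 1) _ _ (by omega) e.2
    simp only [driver, Nat.add_eq_zero_iff, one_ne_zero, and_false, if_false, Measure.real]
    rw [this, ENNReal.toReal_ofReal (by positivity)]
  · rw [edgeProb]
    field_simp
    ring

/-- Only almost sure: `X 0` may take other integer values, but its probabilities at 0 and 1 add up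
to one. -/
theorem ae_eq_edgeChain [IsProbabilityMeasure P] (h : IsStationaryTWHM P θ ε X) (e : NodePair p) :
    ∀ᵐ ω ∂P, ∀ t, (X t e.1.1 e.1.2 ω : ℝ) = edgeChain (fun s => driver ε X e s ω) t := by
  have p0 := edgeWeight_pos θ 0 e.1.1 e.1.2
  have hm1 : MeasurableSet {ω | X 0 e.1.1 e.1.2 ω = 1} :=
    h.measurable_init _ _ e.2 (measurableSet_singleton 1)
  have hm0 : MeasurableSet {ω | X 0 e.1.1 e.1.2 ω = 0} :=
    h.measurable_init _ _ e.2 (measurableSet_singleton 0)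
  have hinit : ∀ᵐ ω ∂P, ω ∈ {ω | X 0 e.1.1 e.1.2 ω = 1} ∪ {ω | X 0 e.1.1 e.1.2 ω = 0} := by
    refine (mem_ae_iff_prob_eq_one (hm1.union hm0)).2 ?_
    rw [measure_union ?_ hm0, h.init_one _ _ e.2,
      h.init_zero _ _ e.2, ← ENNReal.ofReal_add (by positivity) (by positivity)]
    · rw [← ENNReal.ofReal_one]
      congr 1
      field_simp
      ring
    · rw [Set.disjoint_left]
      intro ω h1 h2
      exact absurd (h1.symm.trans h2) one_ne_zero
  filter_upwards [hinit] with ω hω t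
  induction t with
  | zero =>
    rcases hω with hω | hω <;> change X 0 e.1.1 e.1.2 ω = _ at hω <;>
      simp [edgeChain, driver, hω]
  | succ t ih =>
    rw [h.step t _ _ e.2 ω]
    simp only [edgeChain, driver] at ih ⊢
    push_cast
    rw [ih]

theorem iIndepFun_driver (h : IsStationaryTWHM P θ ε X) :
    iIndepFun (fun (e : NodePair p) ω t => driver ε X e t ω) P :=
  iIndepFun.curry (X := fun t e => driver ε X e t) (fun t e => h.measurable_driver e t) h.indep

theorem nodePair_eq (h : IsStationaryTWHM P θ ε X) (i j : Fin p) (hij : j ≠ i) :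
    (∀ t ω, X t (nodePair i j hij).1.1 (nodePair i j hij).1.2 ω = X t i j ω) ∧
    edgeProb θ (nodePair i j hij).1.1 (nodePair i j hij).1.2 = edgeProb θ i j ∧
    edgePairProb θ (nodePair i j hij).1.1 (nodePair i j hij).1.2 = edgePairProb θ i j := by
  by_cases hlt : i < j
  · simp [nodePair, hlt]
  · simp [nodePair, hlt, h.symm _ j i, edgeProb, edgePairProb, edgeWeight_comm θ _ j i]

theorem hasSubgaussianMGF_edge [IsProbabilityMeasure P] (h : IsStationaryTWHM P θ ε X) {A : NNReal}
    (hA : ∀ i j, i ≠ j → edgeWeight θ 1 i j ≤ A) {n : ℕ} (hn : 1 ≤ n) (e : NodePair p) :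
    HasSubgaussianMGF (fun ω => ∑ t ∈ Finset.range n,
        (edgeChain (fun s => driver ε X e s ω) (t + 1) - edgeProb θ e.1.1 e.1.2))
      (1024 * (1 + A) ^ 2 * n) P ∧
    HasSubgaussianMGF (fun ω => ∑ t ∈ Finset.range n,
        (edgeChain (fun s => driver ε X e s ω) (t + 1) * edgeChain (fun s => driver ε X e s ω) t
          - edgePairProb θ e.1.1 e.1.2))
      (1024 * (1 + A) ^ 2 * n) P := by
  have p0 := edgeWeight_pos θ 0 e.1.1 e.1.2
  have p1 := edgeWeight_pos θ 1 e.1.1 e.1.2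
  have hA' := hA e.1.1 e.1.2 e.2.ne
  have hd := h.edgeDriver e
  set α₀ := edgeWeight θ 0 e.1.1 e.1.2 with hα₀
  set α₁ := edgeWeight θ 1 e.1.1 e.1.2 with hα₁
  have hρ0 : 0 ≤ α₁ / (1 + α₀ + α₁) := by positivity
  have hρ : α₁ / (1 + α₀ + α₁) < 1 := by rw [div_lt_one (by positivity)]; linarith
  have ha0 : 0 ≤ α₀ / (1 + α₀ + α₁) := by positivity
  have hsum : α₀ / (1 + α₀ + α₁) + α₁ / (1 + α₀ + α₁) = 1 - 1 / (1 + α₀ + α₁) := by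
    field_simp
    ring
  have haρ : α₀ / (1 + α₀ + α₁) + α₁ / (1 + α₀ + α₁) ≤ 1 := by
    rw [hsum]
    have : 0 < 1 / (1 + α₀ + α₁) := by positivity
    linarith
  -- Here `1 / (1 - ρ) = (1 + α₀ + α₁) / (1 + α₀) ≤ 1 + α₁`, so an upper bound on `α₁` alone
  -- controls the dependence in time.
  have hL : 1 / (1 - α₁ / (1 + α₀ + α₁)) ≤ ((1 + A : NNReal) : ℝ) := by
    have e1 : 1 - α₁ / (1 + α₀ + α₁) = (1 + α₀) / (1 + α₀ + α₁) := by
      field_simp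
      ring
    rw [e1, one_div_div, div_le_iff₀ (by positivity)]
    push_cast
    nlinarith
  constructor
  · refine (hd.hasSubgaussianMGF_sum hρ0 hρ hL hn).weaken ?_
    gcongr
    norm_num
  · have := hd.hasSubgaussianMGF_sum_mul hρ0 hρ ha0 haρ hL hn
    rw [hsum] at this
    exact this

theorem hasSubgaussianMGF_node (h : IsStationaryTWHM P θ ε X) (i : Fin p) (c : NNReal)
    (F : NodePair p → (ℕ → ℤ) → ℝ) (hF : ∀ e, Measurable (F e))
    (hsub : ∀ e, HasSubgaussianMGF (fun ω => F e fun t => driver ε X e t ω) c P) (Y : Ω → ℝ)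
    (hY : ∀ᵐ ω ∂P, Y ω = ∑ j : {j : Fin p // j ≠ i},
      F (nodePair i j.1 j.2) fun t => driver ε X (nodePair i j.1 j.2) t ω) :
    HasSubgaussianMGF Y (p * c) P := by
  have h1 : iIndepFun (fun (j : {j : Fin p // j ≠ i}) ω =>
      F (nodePair i j.1 j.2) fun t => driver ε X (nodePair i j.1 j.2) t ω) P :=
    (h.iIndepFun_driver.precomp (nodePair_injective i)).comp
      (fun j => F (nodePair i j.1 j.2)) fun j => hF _
  have h2 := HasSubgaussianMGF.sum_of_iIndepFun h1 (s := Finset.univ) (c := fun _ => c)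
    fun j _ => hsub _
  refine (h2.weaken ?_).congr (hY.mono fun ω hω => hω.symm)
  rw [Finset.sum_const, nsmul_eq_mul]
  gcongr
  exact (Finset.card_le_univ _).trans ((Fintype.card_subtype_le _).trans (by simp))

/-- Centred degree of node `i`, summed over time. -/
noncomputable def degreeDev (θ : TWHMParam p) (X : ℕ → Fin p → Fin p → Ω → ℤ) (n : ℕ) (i : Fin p)
    (ω : Ω) : ℝ :=
  ∑ t ∈ Finset.Icc 1 n, ∑ j ∈ Finset.univ.erase i, ((X t i j ω : ℝ) - edgeProb θ i j)

/-- Centred number of persistent edges at node `i`, summed over time. -/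
noncomputable def persistDev (θ : TWHMParam p) (X : ℕ → Fin p → Fin p → Ω → ℤ) (n : ℕ) (i : Fin p)
    (ω : Ω) : ℝ :=
  ∑ t ∈ Finset.Icc 1 n, ∑ j ∈ Finset.univ.erase i,
    ((X t i j ω : ℝ) * (X (t - 1) i j ω : ℝ) - edgePairProb θ i j)

theorem sum_Icc_eq_sum_range (n : ℕ) (f : ℕ → ℝ) :
    ∑ t ∈ Finset.Icc 1 n, f t = ∑ t ∈ Finset.range n, f (t + 1) := by
  rw [Finset.range_eq_Ico, Finset.sum_Ico_add' f 0 n 1]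
  rfl

theorem sum_Icc_erase_eq (n : ℕ) (i : Fin p) (f : ℕ → Fin p → ℝ) :
    ∑ t ∈ Finset.Icc 1 n, ∑ j ∈ Finset.univ.erase i, f t j
      = ∑ j : {j : Fin p // j ≠ i}, ∑ t ∈ Finset.range n, f (t + 1) j := by
  rw [Finset.sum_comm]
  simp_rw [sum_Icc_eq_sum_range]
  exact Finset.sum_subtype (F := inferInstance) _ (by simp) _

theorem hasSubgaussianMGF_dev [IsProbabilityMeasure P] (h : IsStationaryTWHM P θ ε X) {A : NNReal}
    (hA : ∀ i j, i ≠ j → edgeWeight θ 1 i j ≤ A) {n : ℕ} (hn : 1 ≤ n) (i : Fin p) :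
    HasSubgaussianMGF (degreeDev θ X n i) (p * (1024 * (1 + A) ^ 2 * n)) P ∧
    HasSubgaussianMGF (persistDev θ X n i) (p * (1024 * (1 + A) ^ 2 * n)) P := by
  have hae : ∀ᵐ ω ∂P, ∀ (e : NodePair p) (t : ℕ), (X t e.1.1 e.1.2 ω : ℝ)
      = edgeChain (fun s => driver ε X e s ω) t := ae_all_iff.2 h.ae_eq_edgeChain
  have hmeas := measurable_edgeChain
  constructor
  · refine h.hasSubgaussianMGF_node i _ (fun e w => ∑ t ∈ Finset.range n,
      (edgeChain w (t + 1) - edgeProb θ e.1.1 e.1.2)) (fun e => by fun_prop)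
      (fun e => (h.hasSubgaussianMGF_edge hA hn e).1) _ ?_
    filter_upwards [hae] with ω hω
    rw [degreeDev, sum_Icc_erase_eq n i fun t j => (X t i j ω : ℝ) - edgeProb θ i j]
    refine Finset.sum_congr rfl fun j _ => Finset.sum_congr rfl fun t _ => ?_
    obtain ⟨e1, e2, -⟩ := h.nodePair_eq i j.1 j.2
    rw [← hω, e1, e2]
  · refine h.hasSubgaussianMGF_node i _ (fun e w => ∑ t ∈ Finset.range n,
      (edgeChain w (t + 1) * edgeChain w t - edgePairProb θ e.1.1 e.1.2)) (fun e => by fun_prop)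
      (fun e => (h.hasSubgaussianMGF_edge hA hn e).2) _ ?_
    filter_upwards [hae] with ω hω
    rw [persistDev, sum_Icc_erase_eq n i
      fun t j => (X t i j ω : ℝ) * (X (t - 1) i j ω : ℝ) - edgePairProb θ i j]
    refine Finset.sum_congr rfl fun j _ => Finset.sum_congr rfl fun t _ => ?_
    obtain ⟨e1, -, e3⟩ := h.nodePair_eq i j.1 j.2
    rw [← hω, ← hω, e1, e1, e3]
    simp

/-- Uniform concentration of the moment statistics. -/
theorem measureReal_dev_le [IsProbabilityMeasure P] (h : IsStationaryTWHM P θ ε X) {A : NNReal}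
    (hA : ∀ i j, i ≠ j → edgeWeight θ 1 i j ≤ A) {n : ℕ} (hn : 1 ≤ n) {x : ℝ} (hx : 0 ≤ x) :
    P.real {ω | ∃ i, x ≤ |degreeDev θ X n i ω| ∨ x ≤ |persistDev θ X n i ω|}
      ≤ 4 * p * Real.exp (-x ^ 2 / (2 * (p * (1024 * (1 + A) ^ 2 * n)))) := by
  have habs : ∀ (Y : Ω → ℝ) (c : NNReal), HasSubgaussianMGF Y c P →
      P.real {ω | x ≤ |Y ω|} ≤ 2 * Real.exp (-x ^ 2 / (2 * c)) := by
    intro Y c hY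
    have h1 : {ω | x ≤ |Y ω|} = {ω | x ≤ Y ω} ∪ {ω | x ≤ (-Y) ω} := by
      ext ω
      simp [le_abs]
    rw [h1]
    refine (measureReal_union_le _ _).trans ?_
    linarith [hY.measure_ge_le hx, hY.neg.measure_ge_le hx]
  have hset : {ω | ∃ i, x ≤ |degreeDev θ X n i ω| ∨ x ≤ |persistDev θ X n i ω|}
      = ⋃ i, ({ω | x ≤ |degreeDev θ X n i ω|} ∪ {ω | x ≤ |persistDev θ X n i ω|}) := by
    ext ω
    simp
  rw [hset]
  refine (measureReal_iUnion_fintype_le _).trans ?_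
  refine (Finset.sum_le_card_nsmul _ _ (4 * Real.exp (-x ^ 2 /
    (2 * (p * (1024 * (1 + A) ^ 2 * n))))) fun i _ => ?_).trans (le_of_eq ?_)
  · refine (measureReal_union_le _ _).trans ?_
    have h1 := habs _ _ (h.hasSubgaussianMGF_dev hA hn i).1
    have h2 := habs _ _ (h.hasSubgaussianMGF_dev hA hn i).2
    push_cast at h1 h2
    linarith
  · simp
    ring

end IsStationaryTWHM

/-! ### Elementary bounds for the response functions. -/

/-- For negative `y`, `e^y ≤ 1 / (1 - y) ≤ 1 + y / 2` on `[-1, 0]`. -/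
theorem half_sq_le_exp_sub_one_mul {y : ℝ} (hy : |y| ≤ 1) : y ^ 2 / 2 ≤ (Real.exp y - 1) * y := by
  have h1 := abs_le.1 hy
  rcases le_total 0 y with h | h
  · nlinarith [Real.add_one_le_exp y]
  · have h2 := Real.add_one_le_exp (-y)
    have h3 : Real.exp y * Real.exp (-y) = 1 := by rw [← Real.exp_add]; simp
    have h4 : Real.exp y * (1 - y) ≤ 1 := by
      nlinarith [Real.exp_pos y]
    have h5 : Real.exp y ≤ 1 + y / 2 := by
      by_contra hc
      push Not at hc
      nlinarith
    nlinarith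

/-- The response `c (1 - 1 / (D + e^{b + y}))` has slope at least `c e^b / (2 G²)` near `y = 0`. -/
theorem response_slope {c D G b y : ℝ} (hc : 0 ≤ c) (hD : 0 < D)
    (hG : D + Real.exp (b + 1) ≤ G) (hy : |y| ≤ 1) :
    c * Real.exp b / (2 * G ^ 2) * y ^ 2 ≤
      (c * (1 - 1 / (D + Real.exp (b + y))) - c * (1 - 1 / (D + Real.exp (b + 0)))) * y := by
  have h1 := abs_le.1 hy
  have e0 : 0 < D + Real.exp (b + y) := by positivity
  have e1 : 0 < D + Real.exp b := by positivity
  have g0 : D + Real.exp (b + y) ≤ G := le_trans (by gcongr; linarith) hG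
  have g1 : D + Real.exp b ≤ G := le_trans (by gcongr; linarith) hG
  have key : (c * (1 - 1 / (D + Real.exp (b + y))) - c * (1 - 1 / (D + Real.exp (b + 0)))) * y
      = c * Real.exp b * ((Real.exp y - 1) * y) / ((D + Real.exp (b + y)) * (D + Real.exp b)) := by
    rw [add_zero]
    field_simp
    rw [Real.exp_add]
    ring
  rw [key]
  calc c * Real.exp b / (2 * G ^ 2) * y ^ 2 = c * Real.exp b * (y ^ 2 / 2) / (G * G) := by
        have : 0 < G := e1.trans_le g1
        field_simp
    _ ≤ _ := by
        have := half_sq_le_exp_sub_one_mul hy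
        have h2 : 0 ≤ (Real.exp y - 1) * y := le_trans (by positivity) this
        have hG0 : 0 ≤ G := e1.le.trans g1
        gcongr

theorem response_strictMono {c D b : ℝ} (hc : 0 < c) (hD : 0 < D) :
    StrictMono fun y => c * (1 - 1 / (D + Real.exp (b + y))) := by
  intro y z hyz
  have : Real.exp (b + y) < Real.exp (b + z) := Real.exp_lt_exp.2 (by linarith)
  refine mul_lt_mul_of_pos_left (sub_lt_sub_left ?_ _) hc
  exact one_div_lt_one_div_of_lt (by positivity) (by linarith)

theorem continuous_response {c D b : ℝ} (hD : 0 < D) :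
    Continuous fun y => c * (1 - 1 / (D + Real.exp (b + y))) := by
  refine continuous_const.mul (continuous_const.sub (continuous_const.div (by fun_prop) fun y => ?_))
  positivity

/-- Puts the static response in the shape of the dynamic one, with `c = D = 1`, so that both share
the slope and monotonicity lemmas. -/
theorem odds_eq {x : ℝ} (hx : 0 < x) : x / (1 + x) = 1 * (1 - 1 / (1 + x)) := by
  field_simp
  ring

theorem abs_one_sub_inv_sub_le {D a b : ℝ} (hD : 1 ≤ D) (ha : 0 ≤ a) (hb : 0 ≤ b) :
    |(1 - 1 / (D + a)) - (1 - 1 / (D + b))| ≤ |a - b| := by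
  have h1 : (1 - 1 / (D + a)) - (1 - 1 / (D + b)) = (a - b) / ((D + a) * (D + b)) := by
    field_simp
    ring
  rw [h1, abs_div]
  refine div_le_self (abs_nonneg _) ?_
  rw [abs_of_pos (by positivity)]
  nlinarith

theorem one_sub_inv_mem {D : ℝ} (hD : 1 ≤ D) : |1 - 1 / D| ≤ 1 := by
  have h1 : 1 / D ≤ 1 := by rw [div_le_one (by linarith)]; exact hD
  have h2 : 0 ≤ 1 / D := by positivity
  rw [abs_le]
  constructor <;> linarith

/-- A product of two 1-Lipschitz factors bounded by 1. It carries the static estimation error into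
the dynamic equations. -/
theorem abs_persist_sub_le {a b x : ℝ} (ha : 0 < a) (hb : 0 < b) (hx : 0 ≤ x) :
    |a / (1 + a) * (1 - 1 / (1 + a + x)) - b / (1 + b) * (1 - 1 / (1 + b + x))|
      ≤ 2 * |a - b| := by
  rw [odds_eq ha, odds_eq hb, one_mul, one_mul]
  have h1 := abs_one_sub_inv_sub_le le_rfl ha.le hb.le
  have h2 := abs_one_sub_inv_sub_le (D := 1 + x) (by linarith) ha.le hb.le
  have h3 := one_sub_inv_mem (D := 1 + a) (by linarith)
  have h4 := one_sub_inv_mem (D := 1 + x + b) (by linarith)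
  rw [add_right_comm 1 a x, add_right_comm 1 b x]
  calc _ = |(1 - 1 / (1 + a)) * ((1 - 1 / (1 + x + a)) - (1 - 1 / (1 + x + b)))
        + ((1 - 1 / (1 + a)) - (1 - 1 / (1 + b))) * (1 - 1 / (1 + x + b))| := by
        congr 1
        ring
    _ ≤ |1 - 1 / (1 + a)| * |(1 - 1 / (1 + x + a)) - (1 - 1 / (1 + x + b))|
        + |(1 - 1 / (1 + a)) - (1 - 1 / (1 + b))| * |1 - 1 / (1 + x + b)| := by
        rw [← abs_mul, ← abs_mul]
        exact abs_add_le _ _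
    _ ≤ 1 * |a - b| + |a - b| * 1 := by gcongr
    _ = 2 * |a - b| := by ring

theorem abs_exp_sub_exp_le {b b' G : ℝ} (hb : Real.exp b ≤ G) (hb' : Real.exp b' ≤ G) :
    |Real.exp b - Real.exp b'| ≤ G * |b - b'| := by
  have key : ∀ x y : ℝ, Real.exp x ≤ G → y ≤ x → Real.exp x - Real.exp y ≤ G * (x - y) := by
    intro x y hx hxy
    have h1 := Real.add_one_le_exp (y - x)
    have h2 : Real.exp y = Real.exp x * Real.exp (y - x) := by rw [← Real.exp_add]; ring_nf
    rw [h2]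
    nlinarith [Real.exp_pos x]
  rcases le_total b b' with h | h
  · rw [abs_sub_comm, abs_sub_comm b, abs_of_nonneg (sub_nonneg.2 h),
      abs_of_nonneg (sub_nonneg.2 (Real.exp_le_exp.2 h))]
    exact key _ _ hb' h
  · rw [abs_of_nonneg (sub_nonneg.2 h), abs_of_nonneg (sub_nonneg.2 (Real.exp_le_exp.2 h))]
    exact key _ _ hb h

theorem four_mul_div_le {p : ℕ} (hp : 3 ≤ p) {m q : ℝ} (hm : 0 < m) (hq : 0 ≤ q) :
    4 * (p * q) / (m * ((p : ℝ) - 2)) ≤ 12 * q / m := by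
  have hp' : (3 : ℝ) ≤ p := by exact_mod_cast hp
  rw [div_le_div_iff₀ (mul_pos hm (by linarith)) hm]
  have h1 : 0 ≤ q * m := by positivity
  nlinarith

/-! ### Uniqueness and local existence of the estimate. -/

theorem IsMME.unique {p : ℕ} (hp : 3 ≤ p) {n : ℕ} (hn : 1 ≤ n) {x : ℕ → Fin p → Fin p → ℤ}
    {η η' : TWHMParam p} (h : IsMME n x η) (h' : IsMME n x η') : η = η' := by
  have hn' : (0 : ℝ) < n := by exact_mod_cast hn
  have h0 : η 0 = η' 0 := by
    refine pairSum_injective hp (fun _ _ y => 1 * (1 - 1 / (1 + Real.exp (0 + y))))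
      (fun _ _ => rfl) (fun _ _ _ => response_strictMono one_pos one_pos) _ _ fun i => ?_
    have e1 := h.1 i
    have e2 := h'.1 i
    simp_rw [odds_eq (edgeWeight_pos _ _ _ _)] at e1 e2
    simp only [edgeWeight, zero_add] at e1 e2 ⊢
    linarith
  have hw : ∀ i j, edgeWeight η' 0 i j = edgeWeight η 0 i j := fun i j => by
    simp only [edgeWeight, h0]
  have h1 : η 1 = η' 1 := by
    refine pairSum_injective hp (fun i j y => edgeWeight η 0 i j / (1 + edgeWeight η 0 i j) *
        (1 - 1 / (1 + edgeWeight η 0 i j + Real.exp (0 + y))))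
      (fun i j => by rw [edgeWeight_comm]) (fun i j _ => ?_) _ _ fun i => ?_
    · have := edgeWeight_pos η 0 i j
      exact response_strictMono (by positivity) (by positivity)
    · have e1 := h.2 i
      have e2 := h'.2 i
      simp_rw [hw] at e2
      simp_rw [Finset.sum_sub_distrib, Finset.sum_const, nsmul_eq_mul] at e1 e2
      have e3 := mul_left_cancel₀ (b := ∑ j ∈ Finset.univ.erase i,
        edgeWeight η 0 i j / (1 + edgeWeight η 0 i j) *
          (1 - 1 / (1 + edgeWeight η 0 i j + edgeWeight η 1 i j)))
        (c := ∑ j ∈ Finset.univ.erase i, edgeWeight η 0 i j / (1 + edgeWeight η 0 i j) *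
          (1 - 1 / (1 + edgeWeight η 0 i j + edgeWeight η' 1 i j))) hn'.ne' (by
        simp only [Nat.card_Icc, Nat.add_sub_cancel] at e1 e2
        linarith)
      simpa [edgeWeight] using e3
  funext r
  fin_cases r
  · exact h0
  · exact h1

/-- Deterministic part of the analysis: if the moment statistics deviate by at most `q n p` from
their expectations, then a method of moments estimate exists near the true parameter. -/
theorem exists_isMME_near.{u} (Cκ B : ℝ) : ∃ C : ℝ, 0 < C ∧
    ∀ {p n : ℕ} (_ : 3 ≤ p) (_ : 1 ≤ n) {Ω : Type u} (X : ℕ → Fin p → Fin p → Ω → ℤ) (ω : Ω)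
      (θ : TWHMParam p) (κ₀ κ₁ q : ℝ), 0 ≤ κ₁ → 0 ≤ q →
      (∀ i, -κ₀ ≤ θ 0 i ∧ θ 0 i ≤ Cκ) → (∀ i, -κ₁ ≤ θ 1 i ∧ θ 1 i ≤ B) →
      (∀ i, |IsStationaryTWHM.degreeDev θ X n i ω| ≤ n * (p * q)) →
      (∀ i, |IsStationaryTWHM.persistDev θ X n i ω| ≤ n * (p * q)) →
      C * (q * Real.exp (4 * κ₀ + 2 * κ₁)) < 1 / 2 →
      ∃ η, IsMME n (fun t i j => X t i j ω) η ∧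
        ‖η - θ‖ ≤ C * (q * Real.exp (4 * κ₀ + 2 * κ₁)) := by
  set G : ℝ := 1 + Real.exp (2 * Cκ + 1) + Real.exp (2 * B + 1) with hGdef
  have hG1 : 1 ≤ G := by
    have h1 := Real.exp_pos (2 * Cκ + 1)
    have h2 := Real.exp_pos (2 * B + 1)
    linarith
  have hG0 : 0 < G := by linarith
  have hGC : Real.exp (2 * Cκ + 1) ≤ G := by
    have h2 := Real.exp_pos (2 * B + 1)
    linarith
  -- `6984 = 24 * 3 * 97`: 24 from `12 / m₁`, 3 from `e ≤ 3`, and 97 from `q + 96 G³ e^{2κ₀} q`; see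
  -- `hr₁`.
  refine ⟨6984 * G ^ 6, by positivity, ?_⟩
  intro p n hp hn Ω X ω θ κ₀ κ₁ q hκ₁ hq hθ₀ hθ₁ hdeg hper hsmall
  have hn' : (0 : ℝ) < n := by exact_mod_cast hn
  have hp' : (3 : ℝ) ≤ p := by exact_mod_cast hp
  -- `κ₀` may be negative, but being bounded below it lets a factor `G` absorb missing powers of
  -- `e^{κ₀}`.
  have hκ₀ : -Cκ ≤ κ₀ := by
    have := hθ₀ ⟨0, by omega⟩
    linarith [this.1, this.2]
  set R := 6984 * G ^ 6 * (q * Real.exp (4 * κ₀ + 2 * κ₁)) with hR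
  set m₀ : ℝ := Real.exp (-(2 * κ₀)) / (2 * G ^ 2) with hm₀
  have hm₀pos : 0 < m₀ := by positivity
  set r₀ : ℝ := 24 * G ^ 2 * (Real.exp (2 * κ₀) * q) with hr₀
  have hr₀0 : 0 ≤ r₀ := by positivity
  have hr₀' : 12 * q / m₀ = r₀ := by
    rw [hm₀, hr₀, Real.exp_neg]
    field_simp
    ring
  have hexp₀ : Real.exp (2 * κ₀) ≤ G * Real.exp (4 * κ₀ + 2 * κ₁) := by
    refine le_trans ?_ (mul_le_mul_of_nonneg_right hGC (Real.exp_pos _).le)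
    rw [← Real.exp_add]
    exact Real.exp_le_exp.2 (by linarith)
  have hr₀R : r₀ ≤ R := by
    calc r₀ ≤ 24 * G ^ 2 * (G * Real.exp (4 * κ₀ + 2 * κ₁) * q) := by rw [hr₀]; gcongr
      _ = 24 * G ^ 3 * (q * Real.exp (4 * κ₀ + 2 * κ₁)) := by ring
      _ ≤ R := by
        rw [hR]
        gcongr
        · norm_num
        · norm_num
  have hstat₀ : 4 * ((p : ℝ) * q) / (m₀ * ((p : ℝ) - 2)) ≤ r₀ :=
    (four_mul_div_le hp hm₀pos hq).trans hr₀'.le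
  obtain ⟨u, hu, hueq⟩ : ∃ u : Fin p → ℝ,
      (∀ i, |u i| ≤ 4 * ((p : ℝ) * q) / (m₀ * ((p : ℝ) - 2))) ∧
      ∀ i, ∑ j ∈ Finset.univ.erase i, 1 * (1 - 1 / (1 + Real.exp (θ 0 i + θ 0 j + (u i + u j))))
        = (∑ t ∈ Finset.Icc 1 n, ∑ j ∈ Finset.univ.erase i, (X t i j ω : ℝ)) / (n : ℝ) := by
    -- Radius 1/2 keeps all pair sums in `|y| ≤ 1`, the range of `response_slope`.
    refine exists_pairSum_eq hp
      (fun i j y => 1 * (1 - 1 / (1 + Real.exp (θ 0 i + θ 0 j + y))))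
      (fun i j => by simp only [add_comm (θ 0 i)]) (fun i j => continuous_response one_pos)
      (fun i => (∑ t ∈ Finset.Icc 1 n, ∑ j ∈ Finset.univ.erase i, (X t i j ω : ℝ)) / (n : ℝ))
      (m := m₀) (s := p * q) (r := 1 / 2) hm₀pos (by norm_num) ?_ ?_
      ((hstat₀.trans hr₀R).trans_lt hsmall)
    · intro i j _ y hy
      refine le_trans ?_ (response_slope (G := G) zero_le_one one_pos ?_ (by linarith))
      · rw [hm₀, one_mul]
        gcongr
        linarith [(hθ₀ i).1, (hθ₀ j).1]
      · have : Real.exp (θ 0 i + θ 0 j + 1) ≤ Real.exp (2 * Cκ + 1) :=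
          Real.exp_le_exp.2 (by linarith [(hθ₀ i).2, (hθ₀ j).2])
        have h2 := Real.exp_pos (2 * B + 1)
        linarith
    · intro i
      have h1 := hdeg i
      have h2 : (∑ t ∈ Finset.Icc 1 n, ∑ j ∈ Finset.univ.erase i, (X t i j ω : ℝ)) / (n : ℝ)
          - ∑ j ∈ Finset.univ.erase i, 1 * (1 - 1 / (1 + Real.exp (θ 0 i + θ 0 j + 0)))
          = IsStationaryTWHM.degreeDev θ X n i ω / n := by
        simp_rw [IsStationaryTWHM.degreeDev, Finset.sum_sub_distrib, Finset.sum_const, edgeProb,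
          odds_eq (edgeWeight_pos _ _ _ _), edgeWeight, add_zero]
        rw [sub_div]
        simp only [Nat.card_Icc, Nat.add_sub_cancel, nsmul_eq_mul]
        field_simp
      rw [h2, abs_div, abs_of_pos hn', div_le_iff₀ hn']
      linarith
  have hur : ∀ i, |u i| ≤ r₀ := fun i => (hu i).trans hstat₀
  have hu1 : ∀ i, |u i| ≤ 1 / 2 := fun i => (hur i).trans (hr₀R.trans hsmall.le)
  set η₀ : Fin p → ℝ := fun i => θ 0 i + u i with hη₀
  set α : Fin p → Fin p → ℝ := fun i j => Real.exp (η₀ i + η₀ j) with hα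
  have hαpos : ∀ i j, 0 < α i j := fun i j => Real.exp_pos _
  have hαsymm : ∀ i j, α i j = α j i := fun i j => by simp only [hα, add_comm (η₀ i)]
  have hαup : ∀ i j, α i j ≤ Real.exp (2 * Cκ + 1) := fun i j => by
    refine Real.exp_le_exp.2 ?_
    have h1 := (abs_le.1 (hu1 i)).2
    have h2 := (abs_le.1 (hu1 j)).2
    simp only [hη₀]
    linarith [(hθ₀ i).2, (hθ₀ j).2]
  have hαlow : ∀ i j, Real.exp (-(2 * κ₀) - 1) ≤ α i j := fun i j => by
    refine Real.exp_le_exp.2 ?_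
    have h1 := (abs_le.1 (hu1 i)).1
    have h2 := (abs_le.1 (hu1 j)).1
    simp only [hη₀]
    linarith [(hθ₀ i).1, (hθ₀ j).1]
  -- The first quotient bounds the prefactor `α / (1 + α)` below, the `-1` in it allowing for the
  -- static error; this is the second source of `e^{2κ₀}`.
  set m₁ : ℝ := Real.exp (-(2 * κ₀) - 1) / G * Real.exp (-(2 * κ₁)) / (2 * G ^ 2) with hm₁
  have hm₁pos : 0 < m₁ := by positivity
  have hr₁ : 12 * (q + 4 * G * r₀) / m₁ ≤ R := by
    have e1 : 12 * (q + 4 * G * r₀) / m₁ = 24 * Real.exp 1 * G ^ 3 *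
        (Real.exp (2 * κ₀ + 2 * κ₁) * (q + 96 * G ^ 3 * (Real.exp (2 * κ₀) * q))) := by
      rw [hm₁, hr₀, Real.exp_sub, Real.exp_neg, Real.exp_neg, Real.exp_add]
      field_simp
      ring
    have e2 : 1 ≤ G * Real.exp (2 * κ₀) := by
      refine le_trans ?_ (mul_le_mul_of_nonneg_right hGC (Real.exp_pos _).le)
      rw [← Real.exp_add]
      exact Real.one_le_exp (by linarith)
    have e3 : q + 96 * G ^ 3 * (Real.exp (2 * κ₀) * q)
        ≤ 97 * G ^ 3 * (Real.exp (2 * κ₀) * q) := by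
      have e4 : 1 ≤ G ^ 3 * Real.exp (2 * κ₀) := by
        refine e2.trans ?_
        gcongr
        exact le_self_pow₀ hG1 (by norm_num)
      nlinarith
    have e5 : Real.exp 1 ≤ 3 := by linarith [Real.exp_one_lt_d9]
    have e6 : Real.exp (2 * κ₀ + 2 * κ₁) * Real.exp (2 * κ₀) = Real.exp (4 * κ₀ + 2 * κ₁) := by
      rw [← Real.exp_add]
      ring_nf
    rw [e1]
    calc _ ≤ 24 * 3 * G ^ 3 * (Real.exp (2 * κ₀ + 2 * κ₁) *
          (97 * G ^ 3 * (Real.exp (2 * κ₀) * q))) := by gcongr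
      _ = R := by
        rw [hR, ← e6]
        ring
  have hstat₁ : 4 * ((p : ℝ) * (q + 4 * G * r₀)) / (m₁ * ((p : ℝ) - 2)) ≤ R :=
    (four_mul_div_le hp hm₁pos (by positivity)).trans hr₁
  obtain ⟨v, hv, hveq⟩ : ∃ v : Fin p → ℝ,
      (∀ i, |v i| ≤ 4 * ((p : ℝ) * (q + 4 * G * r₀)) / (m₁ * ((p : ℝ) - 2))) ∧
      ∀ i, ∑ j ∈ Finset.univ.erase i, α i j / (1 + α i j) *
        (1 - 1 / (1 + α i j + Real.exp (θ 1 i + θ 1 j + (v i + v j))))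
        = (∑ t ∈ Finset.Icc 1 n, ∑ j ∈ Finset.univ.erase i,
          (X t i j ω : ℝ) * (X (t - 1) i j ω : ℝ)) / (n : ℝ) := by
    refine exists_pairSum_eq hp
      (fun i j y => α i j / (1 + α i j) *
        (1 - 1 / (1 + α i j + Real.exp (θ 1 i + θ 1 j + y))))
      (fun i j => by simp only [add_comm (θ 1 i), hαsymm i])
      (fun i j => continuous_response (by linarith [hαpos i j]))
      (fun i => (∑ t ∈ Finset.Icc 1 n, ∑ j ∈ Finset.univ.erase i,
        (X t i j ω : ℝ) * (X (t - 1) i j ω : ℝ)) / (n : ℝ))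
      (m := m₁) (s := p * (q + 4 * G * r₀)) (r := 1 / 2) hm₁pos (by norm_num) ?_ ?_
      (hstat₁.trans_lt hsmall)
    · intro i j _ y hy
      have hpos := hαpos i j
      have hup := hαup i j
      have h2 := Real.exp_pos (2 * B + 1)
      refine le_trans ?_ (response_slope (G := G) (by positivity) (by positivity) ?_ (by linarith))
      · rw [hm₁]
        gcongr
        · exact hαlow i j
        · linarith
        · linarith [(hθ₁ i).1, (hθ₁ j).1]
      · have : Real.exp (θ 1 i + θ 1 j + 1) ≤ Real.exp (2 * B + 1) :=
          Real.exp_le_exp.2 (by linarith [(hθ₁ i).2, (hθ₁ j).2])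
        linarith
    · intro i
      have h1 := hper i
      have h2 : (∑ t ∈ Finset.Icc 1 n, ∑ j ∈ Finset.univ.erase i,
            (X t i j ω : ℝ) * (X (t - 1) i j ω : ℝ)) / (n : ℝ)
          - ∑ j ∈ Finset.univ.erase i, α i j / (1 + α i j) *
            (1 - 1 / (1 + α i j + Real.exp (θ 1 i + θ 1 j + 0)))
          = IsStationaryTWHM.persistDev θ X n i ω / n + ∑ j ∈ Finset.univ.erase i,
            (edgePairProb θ i j - α i j / (1 + α i j) *
              (1 - 1 / (1 + α i j + edgeWeight θ 1 i j))) := by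
        simp_rw [IsStationaryTWHM.persistDev, Finset.sum_sub_distrib, Finset.sum_const, add_zero]
        rw [sub_div]
        simp only [Nat.card_Icc, Nat.add_sub_cancel, nsmul_eq_mul, edgeWeight]
        field_simp
        ring
      -- Replacing the true `α₀` by its estimate: 2 from `abs_persist_sub_le`, `G` from the
      -- exponential, `2 r₀` from two coordinates.
      have h3 : ∀ j, |edgePairProb θ i j - α i j / (1 + α i j) *
          (1 - 1 / (1 + α i j + edgeWeight θ 1 i j))| ≤ 4 * G * r₀ := by
        intro j
        refine (abs_persist_sub_le (edgeWeight_pos θ 0 i j) (hαpos i j)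
          (edgeWeight_pos θ 1 i j).le).trans ?_
        have h4 := abs_exp_sub_exp_le (b := θ 0 i + θ 0 j) (b' := η₀ i + η₀ j) (G := G)
          (le_trans (Real.exp_le_exp.2 (by linarith [(hθ₀ i).2, (hθ₀ j).2])) hGC)
          ((hαup i j).trans hGC)
        have h5 : |θ 0 i + θ 0 j - (η₀ i + η₀ j)| ≤ 2 * r₀ := by
          have e : θ 0 i + θ 0 j - (η₀ i + η₀ j) = -(u i + u j) := by
            simp only [hη₀]
            ring
          rw [e, abs_neg]
          exact (abs_add_le _ _).trans (by linarith [hur i, hur j])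
        have h6 : |edgeWeight θ 0 i j - α i j| ≤ G * (2 * r₀) :=
          h4.trans (mul_le_mul_of_nonneg_left h5 hG0.le)
        linarith
      rw [h2]
      refine (abs_add_le _ _).trans ?_
      have h7 : |IsStationaryTWHM.persistDev θ X n i ω / n| ≤ p * q := by
        rw [abs_div, abs_of_pos hn', div_le_iff₀ hn']
        linarith
      have h8 : |∑ j ∈ Finset.univ.erase i, (edgePairProb θ i j - α i j / (1 + α i j) *
          (1 - 1 / (1 + α i j + edgeWeight θ 1 i j)))| ≤ p * (4 * G * r₀) := by
        refine (Finset.abs_sum_le_sum_abs _ _).trans ((Finset.sum_le_card_nsmul _ _ _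
          fun j _ => h3 j).trans ?_)
        rw [nsmul_eq_mul]
        gcongr
        exact (Finset.card_le_univ _).trans (by simp)
      linarith
  set η : TWHMParam p := ![η₀, fun i => θ 1 i + v i] with hη
  have hw₀ : ∀ i j, edgeWeight η 0 i j = α i j := fun i j => rfl
  have hw₁ : ∀ i j, edgeWeight η 1 i j = Real.exp (θ 1 i + θ 1 j + (v i + v j)) := fun i j => by
    change Real.exp ((θ 1 i + v i) + (θ 1 j + v j)) = _
    congr 1
    ring
  refine ⟨η, ⟨fun i => ?_, fun i => ?_⟩, ?_⟩
  · rw [← hueq i, sub_eq_zero]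
    refine Finset.sum_congr rfl fun j _ => ?_
    rw [odds_eq (edgeWeight_pos _ _ _ _), hw₀]
    simp only [hα, hη₀]
    ring_nf
  · have h1 := hveq i
    rw [eq_div_iff hn'.ne'] at h1
    simp_rw [Finset.sum_sub_distrib, Finset.sum_const, hw₀, hw₁]
    simp only [Nat.card_Icc, Nat.add_sub_cancel, nsmul_eq_mul]
    rw [← h1]
    ring
  · have hR0 : 0 ≤ R := by positivity
    refine (pi_norm_le_iff_of_nonneg hR0).2 fun r => (pi_norm_le_iff_of_nonneg hR0).2 fun i => ?_
    fin_cases r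
    · have : (η - θ) 0 i = u i := by simp [hη, hη₀]
      change |(η - θ) 0 i| ≤ R
      rw [this]
      exact (hur i).trans hr₀R
    · have : (η - θ) 1 i = v i := by simp [hη]
      change |(η - θ) 1 i| ≤ R
      rw [this]
      exact (hv i).trans hstat₁

/-! ### Calibration of the tails and passage to the limit. -/

/-- Under one square root this is `L e^{-L/3}` with `L = log N`, since `N = (e^{L/3})³`. -/
theorem tendsto_exp_mul_sqrt_log_div :
    Tendsto (fun N : ℕ => Real.exp (Real.log N / 3) * Real.sqrt (Real.log N / N)) atTop (𝓝 0) := by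
  have h1 : Tendsto (fun y : ℝ => y ^ 1 * Real.exp (-y)) atTop (𝓝 0) :=
    Real.tendsto_pow_mul_exp_neg_atTop_nhds_zero 1
  have h2 : Tendsto (fun N : ℕ => Real.log N / 3) atTop atTop :=
    (Real.tendsto_log_atTop.comp tendsto_natCast_atTop_atTop).atTop_div_const (by norm_num)
  have h3 := ((h1.comp h2).const_mul 3).sqrt
  simp only [mul_zero, Real.sqrt_zero] at h3
  refine h3.congr' ?_
  filter_upwards [eventually_ge_atTop 1] with N hN
  have hN' : (0 : ℝ) < N := by exact_mod_cast hN
  have e1 : Real.exp (Real.log N / 3) = Real.sqrt (Real.exp (Real.log N / 3) ^ 2) :=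
    (Real.sqrt_sq (Real.exp_pos _).le).symm
  rw [e1, ← Real.sqrt_mul (by positivity)]
  congr 1
  have e2 : (N : ℝ) = Real.exp (Real.log N / 3) ^ 3 := by
    rw [← Real.exp_nat_mul]
    push_cast
    rw [mul_div_cancel₀ _ (by norm_num : (3 : ℝ) ≠ 0), Real.exp_log hN']
  simp only [Function.comp_apply, pow_one, Real.exp_neg]
  set E := Real.exp (Real.log N / 3) with hE
  have hE0 : 0 < E := Real.exp_pos _
  have e3 : Real.log N / N = Real.log N / E ^ 3 := by rw [← e2]
  rw [e3]
  field_simp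

theorem one_le_log_of_three_le {p : ℕ} (hp : 3 ≤ p) : 1 ≤ Real.log p := by
  have hp' : (3 : ℝ) ≤ p := by exact_mod_cast hp
  rw [Real.le_log_iff_exp_le (by linarith)]
  linarith [Real.exp_one_lt_d9]

theorem quarter_le_log_of_two_le {n : ℕ} (hn : 2 ≤ n) : 1 / 4 ≤ Real.log n := by
  have hn' : (2 : ℝ) ≤ n := by exact_mod_cast hn
  have := Real.log_le_log (by norm_num) hn'
  linarith [Real.log_two_gt_d9]

/-- With deviations of order `√(log p / (n p))` per observation, the tail bound of
`IsStationaryTWHM.measureReal_dev_le` is at most `δ`. -/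
theorem tail_le {p n : ℕ} (hp : 3 ≤ p) (hn : 1 ≤ n) {V T δ : ℝ} (hV : 0 < V)
    (hδ : 0 < δ) (hT0 : 0 ≤ T) (hT : Real.log (4 / δ) ≤ T) :
    4 * p * Real.exp (-(n * (p * (Real.sqrt (2 * V * (1 + T)) *
      Real.sqrt (Real.log p / (n * p))))) ^ 2 / (2 * (p * (V * n)))) ≤ δ := by
  have hp' : (0 : ℝ) < p := by exact_mod_cast (by omega : 0 < p)
  have hn' : (0 : ℝ) < n := by exact_mod_cast hn
  have hlog := one_le_log_of_three_le hp
  -- One `log p` cancels the union over `p` nodes; the remaining `T log p ≥ log (4 / δ)` gives `δ`.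
  have e1 : -((n : ℝ) * (p * (Real.sqrt (2 * V * (1 + T)) *
      Real.sqrt (Real.log p / (n * p))))) ^ 2 / (2 * (p * (V * n)))
      = -(1 + T) * Real.log p := by
    have e2 := Real.sq_sqrt (show 0 ≤ 2 * V * (1 + T) by positivity)
    have e3 := Real.sq_sqrt (show 0 ≤ Real.log p / ((n : ℝ) * p) by positivity)
    rw [mul_pow, mul_pow, mul_pow, e2, e3]
    field_simp
  rw [e1, neg_mul, add_mul, one_mul, neg_add, Real.exp_add, Real.exp_neg, Real.exp_log hp']
  have e4 : Real.exp (-(T * Real.log p)) ≤ δ / 4 := by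
    have e5 : δ / 4 = Real.exp (-Real.log (4 / δ)) := by
      rw [Real.exp_neg, Real.exp_log (by positivity), inv_div]
    rw [e5]
    refine Real.exp_le_exp.2 ?_
    nlinarith
  calc 4 * p * ((p : ℝ)⁻¹ * Real.exp (-(T * Real.log p)))
      = 4 * Real.exp (-(T * Real.log p)) := by field_simp
    _ ≤ δ := by linarith

/-- By subadditivity of the outer measure, so the event that a good estimate exists need not be
shown measurable. -/
theorem ofReal_one_sub_le_of_compl_subset {Ω : Type*} [MeasurableSpace Ω] {P : Measure Ω}
    [IsProbabilityMeasure P] {S T : Set Ω} (h : Tᶜ ⊆ S) {δ : ℝ} (hδ : P.real T ≤ δ) :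
    ENNReal.ofReal (1 - δ) ≤ P S := by
  have h1 : (1 : ENNReal) ≤ P S + ENNReal.ofReal δ := by
    rw [← measure_univ (μ := P)]
    refine (measure_mono (t := S ∪ T) fun ω _ => ?_).trans
      ((measure_union_le _ _).trans (add_le_add le_rfl ?_))
    · by_cases hω : ω ∈ T
      · exact Or.inr hω
      · exact Or.inl (h hω)
    · rw [← ofReal_measureReal]
      exact ENNReal.ofReal_le_ofReal hδ
  rw [ENNReal.ofReal_sub _ (measureReal_nonneg.trans hδ), ENNReal.ofReal_one]
  exact tsub_le_iff_right.2 h1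

theorem tendsto_one_of_forall_eventually {ι : Type*} {l : Filter ι} {f : ι → ENNReal}
    (h1 : ∀ k, f k ≤ 1) (h : ∀ δ : ℝ, 0 < δ → ∀ᶠ k in l, ENNReal.ofReal (1 - δ) ≤ f k) :
    Tendsto f l (𝓝 1) := by
  refine tendsto_order.2 ⟨fun a ha => ?_, fun a ha => Eventually.of_forall fun k =>
    (h1 k).trans_lt ha⟩
  have ha' : a.toReal < 1 := by
    rw [← ENNReal.toReal_one]
    exact ENNReal.toReal_strict_mono ENNReal.one_ne_top ha
  filter_upwards [h ((1 - a.toReal) / 2) (by linarith)] with k hk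
  refine lt_of_lt_of_le ?_ hk
  have ha0 : 0 ≤ a.toReal := ENNReal.toReal_nonneg
  calc a = ENNReal.ofReal a.toReal := (ENNReal.ofReal_toReal (ha.trans ENNReal.one_lt_top).ne).symm
    _ < ENNReal.ofReal (1 - (1 - a.toReal) / 2) :=
      (ENNReal.ofReal_lt_ofReal_iff (by linarith)).2 (by linarith)

theorem corollary3
    {ι : Type*} (l : Filter ι) (n p : ι → ℕ)
    (hn : ∀ k, 2 ≤ n k) (hp : ∀ k, 3 ≤ p k)
    (hnp : Tendsto (fun k => n k * p k) l atTop)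
    {Ω : ι → Type*} [∀ k, MeasurableSpace (Ω k)]
    (P : ∀ k, Measure (Ω k)) [∀ k, IsProbabilityMeasure (P k)]
    (θ : ∀ k, TWHMParam (p k))
    (ε X : ∀ k, ℕ → Fin (p k) → Fin (p k) → Ω k → ℤ)
    (hX : ∀ k, IsStationaryTWHM (P k) (θ k) (ε k) (X k))
    (K : ℝ) (hA1 : ∀ k i, θ k 1 i - max (θ k 0 i) 0 < K)
    (Cκ : ℝ) (hCκ : 0 < Cκ) (κ₀ κ₁ : ι → ℝ)
    (hθ₁ : ∀ k, ‖θ k 1‖ ≤ κ₁ k)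
    (hθ₀ : ∀ k i, -κ₀ k ≤ θ k 0 i ∧ θ k 0 i ≤ Cκ) :
    Tendsto (fun k => P k {ω | ∀ η η' : TWHMParam (p k),
        IsMME (n k) (fun t i j => X k t i j ω) η →
        IsMME (n k) (fun t i j => X k t i j ω) η' → η = η'}) l (𝓝 1) ∧
    ∀ c : ℝ, c < 1 / 12 →
      (∀ᶠ k in l, κ₀ k + 2 * κ₁ k < c * Real.log ((n k : ℝ) * (p k : ℝ))) →
      Tendsto (fun k => P k {ω | ∃! η : TWHMParam (p k),
          IsMME (n k) (fun t i j => X k t i j ω) η}) l (𝓝 1) ∧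
      ∀ δ : ℝ, 0 < δ → ∃ M : ℝ, 0 < M ∧ ∀ᶠ k in l,
        ENNReal.ofReal (1 - δ) ≤ P k {ω | ∃ η : TWHMParam (p k),
          IsMME (n k) (fun t i j => X k t i j ω) η ∧
          (∀ η' : TWHMParam (p k), IsMME (n k) (fun t i j => X k t i j ω) η' → η' = η) ∧
          ‖η - θ k‖ ≤ M * (Real.exp (4 * κ₀ k + 6 * κ₁ k) *
            Real.sqrt (Real.log (n k : ℝ) * Real.log (p k : ℝ) / ((n k : ℝ) * (p k : ℝ))))} := by
  have hn1 : ∀ k, 1 ≤ n k := fun k => (hn k).trans' (by norm_num)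
  have huniq : ∀ k ω (η η' : TWHMParam (p k)), IsMME (n k) (fun t i j => X k t i j ω) η →
      IsMME (n k) (fun t i j => X k t i j ω) η' → η = η' := fun k ω η η' h h' =>
    h.unique (hp k) (hn1 k) h'
  refine ⟨?_, ?_⟩
  · have : ∀ k, P k {ω | ∀ η η' : TWHMParam (p k),
        IsMME (n k) (fun t i j => X k t i j ω) η →
        IsMME (n k) (fun t i j => X k t i j ω) η' → η = η'} = 1 := fun k => by
      rw [Set.eq_univ_of_forall (s := {ω | _}) fun ω => huniq k ω]
      exact measure_univ
    simp_rw [this]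
    exact tendsto_const_nhds
  intro c hc hκ
  have hmain : ∀ δ : ℝ, 0 < δ → ∃ M : ℝ, 0 < M ∧ ∀ᶠ k in l,
        ENNReal.ofReal (1 - δ) ≤ P k {ω | ∃ η : TWHMParam (p k),
          IsMME (n k) (fun t i j => X k t i j ω) η ∧
          (∀ η' : TWHMParam (p k), IsMME (n k) (fun t i j => X k t i j ω) η' → η' = η) ∧
          ‖η - θ k‖ ≤ M * (Real.exp (4 * κ₀ k + 6 * κ₁ k) *
            Real.sqrt (Real.log (n k : ℝ) * Real.log (p k : ℝ) / ((n k : ℝ) * (p k : ℝ))))} := by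
    intro δ hδ
    obtain ⟨C, hC, hCex⟩ := exists_isMME_near Cκ (K + Cκ)
    set A : NNReal := ⟨Real.exp (2 * (K + Cκ)), (Real.exp_pos _).le⟩ with hAdef
    -- The dynamic parameters are bounded above by a constant, so the sub-Gaussian proxy does not
    -- grow with `κ₁`.
    have hβ₁ : ∀ k i, θ k 1 i ≤ K + Cκ := fun k i => by
      have h1 := hA1 k i
      have h2 : max (θ k 0 i) 0 ≤ Cκ := max_le (hθ₀ k i).2 hCκ.le
      linarith
    have hA : ∀ k i j, i ≠ j → edgeWeight (θ k) 1 i j ≤ A := fun k i j _ =>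
      Real.exp_le_exp.2 (by linarith [hβ₁ k i, hβ₁ k j])
    have hκ₁ : ∀ k, 0 ≤ κ₁ k := fun k => (norm_nonneg _).trans (hθ₁ k)
    set V : ℝ := 1024 * (1 + (A : ℝ)) ^ 2 with hV
    have hVpos : 0 < V := by positivity
    set T : ℝ := max (Real.log (4 / δ)) 0 with hT
    have hT0 : 0 ≤ T := le_max_right _ _
    set M₀ : ℝ := Real.sqrt (2 * V * (1 + T)) with hM₀
    have hM₀pos : 0 < M₀ := Real.sqrt_pos.2 (by positivity)
    refine ⟨C * (M₀ * 2), by positivity, ?_⟩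
    have hlim := (tendsto_exp_mul_sqrt_log_div.comp hnp).const_mul (C * M₀)
    rw [mul_zero] at hlim
    filter_upwards [hκ, hlim.eventually_lt_const (show (0 : ℝ) < 1 / 2 by norm_num)] with k hκk hk
    simp only [Function.comp_apply] at hk
    push_cast at hk
    have hn' : (2 : ℝ) ≤ n k := by exact_mod_cast hn k
    have hp' : (3 : ℝ) ≤ p k := by exact_mod_cast hp k
    have hlp := one_le_log_of_three_le (hp k)
    have hln := quarter_le_log_of_two_le (hn k)
    have hnp0 : (0 : ℝ) < n k * p k := by nlinarith
    have hlogN : Real.log (p k) ≤ Real.log (n k * p k) :=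
      Real.log_le_log (by linarith) (by nlinarith)
    set q : ℝ := M₀ * Real.sqrt (Real.log (p k) / (n k * p k)) with hq
    have hq0 : 0 ≤ q := by positivity
    have hsmall : C * (q * Real.exp (4 * κ₀ k + 2 * κ₁ k)) < 1 / 2 := by
      refine lt_of_le_of_lt ?_ hk
      have h1 : Real.exp (4 * κ₀ k + 2 * κ₁ k) ≤ Real.exp (Real.log (n k * p k) / 3) := by
        refine Real.exp_le_exp.2 ?_
        have h2 : c * Real.log (n k * p k) ≤ 1 / 12 * Real.log (n k * p k) :=
          mul_le_mul_of_nonneg_right hc.le (by linarith)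
        linarith [hκ₁ k]
      have h3 : Real.sqrt (Real.log (p k) / (n k * p k))
          ≤ Real.sqrt (Real.log (n k * p k) / (n k * p k)) :=
        Real.sqrt_le_sqrt (div_le_div_of_nonneg_right hlogN hnp0.le)
      calc C * (q * Real.exp (4 * κ₀ k + 2 * κ₁ k))
          ≤ C * ((M₀ * Real.sqrt (Real.log (n k * p k) / (n k * p k))) *
            Real.exp (Real.log (n k * p k) / 3)) := by rw [hq]; gcongr
        _ = _ := by ring
    have hrate : C * (q * Real.exp (4 * κ₀ k + 2 * κ₁ k)) ≤ C * (M₀ * 2) *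
        (Real.exp (4 * κ₀ k + 6 * κ₁ k) *
          Real.sqrt (Real.log (n k) * Real.log (p k) / (n k * p k))) := by
      have h1 : Real.exp (4 * κ₀ k + 2 * κ₁ k) ≤ Real.exp (4 * κ₀ k + 6 * κ₁ k) :=
        Real.exp_le_exp.2 (by linarith [hκ₁ k])
      -- `n ≥ 2` gives `4 log n ≥ 1`, so inserting the factor `log n` costs at most a factor 2.
      have h2 : Real.sqrt (Real.log (p k) / (n k * p k))
          ≤ 2 * Real.sqrt (Real.log (n k) * Real.log (p k) / (n k * p k)) := by
        have h4 : (2 : ℝ) = Real.sqrt (2 ^ 2) := (Real.sqrt_sq (by norm_num)).symm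
        rw [h4, ← Real.sqrt_mul (by norm_num)]
        refine Real.sqrt_le_sqrt ?_
        rw [← mul_div_assoc]
        refine div_le_div_of_nonneg_right ?_ hnp0.le
        nlinarith
      calc C * (q * Real.exp (4 * κ₀ k + 2 * κ₁ k))
          ≤ C * ((M₀ * (2 * Real.sqrt (Real.log (n k) * Real.log (p k) / (n k * p k)))) *
            Real.exp (4 * κ₀ k + 6 * κ₁ k)) := by rw [hq]; gcongr
        _ = _ := by ring
    have hprob := (hX k).measureReal_dev_le (hA k) (hn1 k)
      (x := n k * (p k * q)) (by positivity)
    refine ofReal_one_sub_le_of_compl_subset ?_ (hprob.trans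
      (tail_le (hp k) (hn1 k) hVpos hδ hT0 (le_max_left _ _)))
    intro ω hω
    have hω' : ∀ i, |IsStationaryTWHM.degreeDev (θ k) (X k) (n k) i ω| < n k * (p k * q) ∧
        |IsStationaryTWHM.persistDev (θ k) (X k) (n k) i ω| < n k * (p k * q) := by
      intro i
      by_contra hcon
      refine hω ⟨i, ?_⟩
      rw [not_and_or, not_lt, not_lt] at hcon
      exact hcon
    have habs : ∀ i, -κ₁ k ≤ θ k 1 i := fun i =>
      (abs_le.1 ((norm_le_pi_norm (θ k 1) i).trans (hθ₁ k))).1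
    obtain ⟨η, hη, hηθ⟩ := hCex (hp k) (hn1 k) (X k) ω (θ k) (κ₀ k) (κ₁ k) q (hκ₁ k) hq0
      (hθ₀ k) (fun i => ⟨habs i, hβ₁ k i⟩) (fun i => (hω' i).1.le) (fun i => (hω' i).2.le) hsmall
    exact ⟨η, hη, fun η' hη' => huniq k ω η' η hη' hη, hηθ.trans hrate⟩
  refine ⟨tendsto_one_of_forall_eventually (fun k => prob_le_one) fun δ hδ => ?_, hmain⟩
  obtain ⟨M, -, hM⟩ := hmain δ hδ
  filter_upwards [hM] with k hk
  refine hk.trans (measure_mono ?_)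
  rintro ω ⟨η, hη, hηu, -⟩
  exact ⟨η, hη, hηu⟩
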